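/- Let $d\ge 0$ be an integer, let $X$ be a metrisable, locally compact space, and let $\mathbf n\mapsto\phi_{\mathbf n}$ be an action of the additive monoid $\mathbb Z_+^d$ on $X$ by continuous proper surjections $\phi_{\mathbf n}:X\to X$ (so $\phi_{\mathbf 0}=\mathrm{id}$ and $\phi_{\mathbf m+\mathbf n}=\phi_{\mathbf m}\circ\phi_{\mathbf n}$). A point $x\in X$ is called *strongly recurrent* if there is a sequence $(\mathbf n_k)_{k}$ in $\mathbb Z_+^d$, each of whose $d$ coordinates is strictly increasing in $k$, such that $\phi_{\mathbf n_k}(x)\to x$. Let $\rho$ be a faithful $*$-representation of $C_0(X)$ (complex-valued functions) on a complex Hilbert space $H_o$. For $\mathbf n\in\mathbb Z_+^d$ and $f\in C_0(X)$ let $\pi(U_{\mathbf n}f)$ be the bounded operator on $H_o\otimes\ell^2(\mathbb Z_+^d)$ with $$\pi(U_{\mathbf n}f)(\xi\otimes e_{\mathbf k})=\rho(f\circ\phi_{\mathbf k})\xi\otimes e_{\mathbf k+\mathbf n}\qquad(\xi\in H_o,\ \mathbf k\in\mathbb Z_+^d),$$ and for $A=(f_{\mathbf n})_{\mathbf n}\in\ell^1(\mathbb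 Z_+^d,C_0(X))$ let $\pi(A)=\sum_{\mathbf n}\pi(U_{\mathbf n}f_{\mathbf n})$. The *analytic crossed product* $C_0(X)\times_\phi\mathbb Z_+^d$ is the norm closure of $\pi\bigl(\ell^1(\mathbb Z_+^d,C_0(X))\bigr)$ in the algebra of bounded operators on $H_o\otimes\ell^2(\mathbb Z_+^d)$; it is a Banach algebra, not necessarily unital. A complex algebra is called *semisimple* if the intersection of its primitive ideals (the kernels of its algebraically irreducible representations) is $\{0\}$, and *semiprime* if the intersection of its prime ideals is $\{0\}$, where a proper two-sided ideal $P$ is prime if $J_1J_2\subseteq P$ implies $J_1\subseteq P$ or $J_2\subseteq P$ for all two-sided ideals $J_1,J_2$. (An intersection over an empty family is the whole algebra.) **Theorem.** The following are equivalent: 1. the strongly recurrent points are dense in $X$; 2. $C_0(X)\times_\phi\mathbb Z_+^d$ is semisimple; 3. $C_0(X)\times_\phi\mathbb Z_+^d$ is semiprime. -/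

import Mathlib

open Set Filter Topology
open scoped ZeroAtInfty ENNReal

noncomputable section

namespace AnalyticCrossedProduct

/-! ## Dynamical systems over `ℤ₊ᵈ` and strong recurrence -/

/-- A dynamical system `(X, Φ)`: an action `n ↦ φ n` of the additive monoid `ℤ₊ᵈ` on `X` by
continuous proper surjections (`IsProperMap` includes continuity). -/
structure DynSystem (d : ℕ) (X : Type*) [TopologicalSpace X] where
  /-- The map `φ n : X → X`. -/
  map : (Fin d → ℕ) → X → X
  isProperMap : ∀ n, IsProperMap (map n)
  surjective : ∀ n, Function.Surjective (map n)
  map_zero : map 0 = id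
  map_add : ∀ m n, map (m + n) = map m ∘ map n

variable {d : ℕ} {X : Type*} [TopologicalSpace X]

/-- `x` is `J`-recurrent: `φ (n k) x → x` for some sequence `n` in `ℤ₊ᵈ` each of whose coordinates
in `J` is strictly increasing. -/
def DynSystem.IsRecurrentIn (φ : DynSystem d X) (J : Set (Fin d)) (x : X) : Prop :=
  ∃ n : ℕ → (Fin d → ℕ), (∀ j ∈ J, StrictMono fun k => n k j) ∧
    Tendsto (fun k => φ.map (n k) x) atTop (𝓝 x)

/-- `x` is strongly recurrent: it is recurrent in all the directions `1, …, d` at once. -/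
def DynSystem.IsStronglyRecurrent (φ : DynSystem d X) (x : X) : Prop :=
  φ.IsRecurrentIn Set.univ x

/-- `φ n` as a cocompact map (preimages of compact sets are compact). -/
def DynSystem.cocompact (φ : DynSystem d X) (n : Fin d → ℕ) : CocompactMap X X where
  toFun := φ.map n
  continuous_toFun := (φ.isProperMap n).continuous
  cocompact_tendsto' := by
    intro s hs
    obtain ⟨K, hK, hKs⟩ := mem_cocompact.1 hs
    exact mem_cocompact.2 ⟨φ.map n ⁻¹' K, (φ.isProperMap n).isCompact_preimage hK,
      fun x hx => hKs hx⟩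

/-- The endomorphism `α n : f ↦ f ∘ φ n` of `C₀(X)`. -/
def DynSystem.α (φ : DynSystem d X) (n : Fin d → ℕ) (f : C₀(X, ℂ)) : C₀(X, ℂ) :=
  f.comp (φ.cocompact n)

@[simp] theorem DynSystem.α_apply (φ : DynSystem d X) (n : Fin d → ℕ) (f : C₀(X, ℂ)) (x : X) :
    φ.α n f x = f (φ.map n x) := rfl

theorem DynSystem.α_add (φ : DynSystem d X) (n : Fin d → ℕ) (f g : C₀(X, ℂ)) :
    φ.α n (f + g) = φ.α n f + φ.α n g := rfl

theorem DynSystem.α_smul (φ : DynSystem d X) (n : Fin d → ℕ) (c : ℂ) (f : C₀(X, ℂ)) :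
    φ.α n (c • f) = c • φ.α n f := rfl

theorem DynSystem.α_mul (φ : DynSystem d X) (n : Fin d → ℕ) (f g : C₀(X, ℂ)) :
    φ.α n (f * g) = φ.α n f * φ.α n g := rfl

theorem DynSystem.α_α (φ : DynSystem d X) (m n : Fin d → ℕ) (f : C₀(X, ℂ)) :
    φ.α m (φ.α n f) = φ.α (n + m) f := by
  ext x
  simp [φ.map_add]

theorem DynSystem.norm_α_le (φ : DynSystem d X) (n : Fin d → ℕ) (f : C₀(X, ℂ)) :
    ‖φ.α n f‖ ≤ ‖f‖ := by
  rw [← ZeroAtInftyContinuousMap.norm_toBCF_eq_norm]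
  refine (BoundedContinuousFunction.norm_le (norm_nonneg _)).2 fun x => ?_
  rw [← ZeroAtInftyContinuousMap.norm_toBCF_eq_norm (f := f)]
  exact f.toBCF.norm_coe_le_norm (φ.map n x)

/-! ## The analytic crossed product -/

variable {H₀ : Type*} [NormedAddCommGroup H₀] [InnerProductSpace ℂ H₀] [CompleteSpace H₀]

/-- The Hilbert space `H₀ ⊗ ℓ²(ℤ₊ᵈ)`, realised as `ℓ²(ℤ₊ᵈ, H₀)`: the vector `ξ ⊗ e k` is the
sequence with the single nonzero entry `ξ`, at `k`. -/
abbrev Fock (d : ℕ) (H₀ : Type*) [NormedAddCommGroup H₀] : Type _ :=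
  lp (fun _ : Fin d → ℕ => H₀) 2

open Classical in
/-- The coordinates of `π (U_n f) ξ`. -/
def monoFun (φ : DynSystem d X) (ρ : C₀(X, ℂ) →⋆ₙₐ[ℂ] (H₀ →L[ℂ] H₀)) (n : Fin d → ℕ)
    (f : C₀(X, ℂ)) (ξ : (Fin d → ℕ) → H₀) (m : Fin d → ℕ) : H₀ :=
  if n ≤ m then ρ (φ.α (m - n) f) (ξ (m - n)) else 0

section monomials

variable (φ : DynSystem d X) (ρ : C₀(X, ℂ) →⋆ₙₐ[ℂ] (H₀ →L[ℂ] H₀))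

theorem monoFun_add_apply (n : Fin d → ℕ) (f : C₀(X, ℂ)) (ξ : (Fin d → ℕ) → H₀)
    (k : Fin d → ℕ) : monoFun φ ρ n f ξ (k + n) = ρ (φ.α k f) (ξ k) := by
  simp [monoFun]

theorem monoFun_eq_zero (n : Fin d → ℕ) (f : C₀(X, ℂ)) (ξ : (Fin d → ℕ) → H₀)
    {m : Fin d → ℕ} (h : ¬ n ≤ m) : monoFun φ ρ n f ξ m = 0 := by
  simp [monoFun, h]

theorem monoFun_support (n : Fin d → ℕ) (f : C₀(X, ℂ)) (ξ : (Fin d → ℕ) → H₀)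
    {m : Fin d → ℕ} (h : m ∉ Set.range (fun k : Fin d → ℕ => k + n)) :
    monoFun φ ρ n f ξ m = 0 := by
  refine monoFun_eq_zero φ ρ n f ξ fun hnm => h ⟨m - n, ?_⟩
  exact tsub_add_cancel_of_le hnm

theorem norm_rho_le (f : C₀(X, ℂ)) : ‖ρ f‖ ≤ ‖f‖ :=
  NonUnitalStarAlgHom.norm_apply_le ρ f

theorem norm_monoFun_le (n : Fin d → ℕ) (f : C₀(X, ℂ)) (ξ : (Fin d → ℕ) → H₀)
    (k : Fin d → ℕ) : ‖monoFun φ ρ n f ξ (k + n)‖ ≤ ‖f‖ * ‖ξ k‖ := by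
  rw [monoFun_add_apply]
  refine ((ρ (φ.α k f)).le_opNorm _).trans ?_
  gcongr
  exact (norm_rho_le ρ _).trans (φ.norm_α_le k f)

theorem monoFun_summable (n : Fin d → ℕ) (f : C₀(X, ℂ)) (ξ : Fock d H₀) :
    Summable (fun m => ‖monoFun φ ρ n f ξ m‖ ^ (2 : ℝ)) ∧
      ∑' m, ‖monoFun φ ρ n f ξ m‖ ^ (2 : ℝ) ≤ (‖f‖ * ‖ξ‖) ^ (2 : ℝ) := by
  have hinj : Function.Injective (fun k : Fin d → ℕ => k + n) := add_left_injective n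
  have hz : ∀ m ∉ Set.range (fun k : Fin d → ℕ => k + n),
      ‖monoFun φ ρ n f ξ m‖ ^ (2 : ℝ) = 0 := fun m hm => by
    rw [monoFun_support φ ρ n f ξ hm]; simp
  have hle : ∀ k, ‖monoFun φ ρ n f ξ (k + n)‖ ^ (2 : ℝ) ≤ ‖f‖ ^ (2 : ℝ) * ‖ξ k‖ ^ (2 : ℝ) :=
    fun k => by
      rw [← Real.mul_rpow (norm_nonneg _) (norm_nonneg _)]
      exact Real.rpow_le_rpow (norm_nonneg _) (norm_monoFun_le φ ρ n f ξ k) (by norm_num)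
  have hξ : Summable fun k => ‖ξ k‖ ^ (2 : ℝ) := by
    simpa using (lp.memℓp ξ).summable (by norm_num)
  have hs : Summable fun k => ‖monoFun φ ρ n f ξ (k + n)‖ ^ (2 : ℝ) :=
    Summable.of_nonneg_of_le (fun k => by positivity) hle (hξ.mul_left _)
  refine ⟨(hinj.summable_iff hz).1 hs, ?_⟩
  have hnorm : ‖ξ‖ ^ (2 : ℝ) = ∑' k, ‖ξ k‖ ^ (2 : ℝ) := by
    simpa using lp.norm_rpow_eq_tsum (p := 2) (by norm_num) ξ
  rw [Real.mul_rpow (norm_nonneg _) (norm_nonneg _), hnorm, ← tsum_mul_left,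
    ← hinj.tsum_eq (f := fun m => ‖monoFun φ ρ n f ξ m‖ ^ (2 : ℝ))
      (fun m hm => by by_contra h; exact hm (hz m h))]
  exact hs.tsum_le_tsum hle (hξ.mul_left _)

theorem monoFun_memℓp (n : Fin d → ℕ) (f : C₀(X, ℂ)) (ξ : Fock d H₀) :
    Memℓp (monoFun φ ρ n f ξ) 2 :=
  memℓp_gen (by simpa using (monoFun_summable φ ρ n f ξ).1)

/-- The bounded operator `π (U_n f)` on `H₀ ⊗ ℓ²(ℤ₊ᵈ)`, for which
`π (U_n f) (ξ ⊗ e k) = (ρ (α k f) ξ) ⊗ e (k + n)`; see `mono_single`. -/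
def mono (n : Fin d → ℕ) (f : C₀(X, ℂ)) : Fock d H₀ →L[ℂ] Fock d H₀ :=
  LinearMap.mkContinuous
    { toFun := fun ξ => ⟨monoFun φ ρ n f ξ, monoFun_memℓp φ ρ n f ξ⟩
      map_add' := fun ξ η => by
        ext m
        change monoFun φ ρ n f _ m = monoFun φ ρ n f _ m + monoFun φ ρ n f _ m
        by_cases h : n ≤ m <;> simp [monoFun, h]
      map_smul' := fun c ξ => by
        ext m
        by_cases h : n ≤ m <;> simp [monoFun, h] }
    ‖f‖ fun ξ => by
      refine lp.norm_le_of_tsum_le (by norm_num) (by positivity) ?_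
      simpa using (monoFun_summable φ ρ n f ξ).2

theorem mono_apply (n : Fin d → ℕ) (f : C₀(X, ℂ)) (ξ : Fock d H₀) (m : Fin d → ℕ) :
    mono φ ρ n f ξ m = monoFun φ ρ n f ξ m := rfl

theorem mono_single (n k : Fin d → ℕ) (f : C₀(X, ℂ)) (v : H₀) :
    mono φ ρ n f (lp.single 2 k v) = lp.single 2 (k + n) (ρ (φ.α k f) v) := by
  ext m
  rw [mono_apply]
  by_cases h : n ≤ m
  · obtain ⟨l, rfl⟩ : ∃ l, m = l + n := ⟨m - n, (tsub_add_cancel_of_le h).symm⟩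
    rw [monoFun_add_apply]
    by_cases hl : l = k
    · subst hl
      simp
    · rw [lp.single_apply_ne _ _ _ hl, lp.single_apply_ne _ _ _ (by simpa using hl), map_zero]
  · rw [monoFun_eq_zero φ ρ n f _ h, lp.single_apply_ne]
    rintro rfl
    exact h le_add_self

theorem norm_mono_le (n : Fin d → ℕ) (f : C₀(X, ℂ)) : ‖mono φ ρ n f‖ ≤ ‖f‖ :=
  LinearMap.mkContinuous_norm_le _ (norm_nonneg _) _

theorem mono_add (n : Fin d → ℕ) (f g : C₀(X, ℂ)) :
    mono φ ρ n (f + g) = mono φ ρ n f + mono φ ρ n g := by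
  ext ξ m
  by_cases h : n ≤ m <;> simp [mono_apply, monoFun, h, φ.α_add]

theorem mono_smul (n : Fin d → ℕ) (c : ℂ) (f : C₀(X, ℂ)) :
    mono φ ρ n (c • f) = c • mono φ ρ n f := by
  ext ξ m
  by_cases h : n ≤ m <;> simp [mono_apply, monoFun, h, φ.α_smul]

/-- The multiplication rule `(U_n f) (U_m g) = U_{n+m} (α m f · g)`. -/
theorem mono_mul (n m : Fin d → ℕ) (f g : C₀(X, ℂ)) :
    mono φ ρ n f * mono φ ρ m g = mono φ ρ (n + m) (φ.α m f * g) := by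
  ext ξ l
  change mono φ ρ n f (mono φ ρ m g ξ) l = _
  rw [mono_apply, mono_apply]
  by_cases h : n + m ≤ l
  · obtain ⟨k, rfl⟩ : ∃ k, l = k + (n + m) := ⟨l - (n + m), (tsub_add_cancel_of_le h).symm⟩
    rw [monoFun_add_apply]
    have e : k + (n + m) = (k + m) + n := by abel
    rw [e, monoFun_add_apply, mono_apply, monoFun_add_apply, φ.α_mul, map_mul, φ.α_α,
      add_comm m k]
    rfl
  · rw [monoFun_eq_zero φ ρ _ _ _ h]
    by_cases h' : n ≤ l
    · obtain ⟨k, rfl⟩ : ∃ k, l = k + n := ⟨l - n, (tsub_add_cancel_of_le h').symm⟩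
      rw [monoFun_add_apply, mono_apply, monoFun_eq_zero φ ρ _ _ _, map_zero]
      intro hk
      exact h (by rw [add_comm n m]; gcongr)
    · exact monoFun_eq_zero φ ρ _ _ _ h'

/-- The representation `π` of `ℓ¹(ℤ₊ᵈ, C₀(X))`: `π (∑ U_n f_n) = ∑ π (U_n f_n)`, an absolutely
convergent series of operators. -/
def l1Rep (A : lp (fun _ : Fin d → ℕ => C₀(X, ℂ)) 1) : Fock d H₀ →L[ℂ] Fock d H₀ :=
  ∑' n, mono φ ρ n (A n)

theorem l1Rep_summable (A : lp (fun _ : Fin d → ℕ => C₀(X, ℂ)) 1) :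
    Summable fun n => mono φ ρ n (A n) := by
  have h : Summable fun n => ‖A n‖ := by
    simpa using (lp.memℓp A).summable (by norm_num)
  exact Summable.of_norm_bounded h fun n => norm_mono_le φ ρ n (A n)

theorem l1Rep_single (n : Fin d → ℕ) (f : C₀(X, ℂ)) :
    l1Rep φ ρ (lp.single 1 n f) = mono φ ρ n f := by
  have h0 : ∀ m, mono φ ρ m (0 : C₀(X, ℂ)) = 0 := fun m => by
    simpa using mono_smul φ ρ m 0 0
  rw [l1Rep, tsum_eq_single n]
  · simp
  · intro m hm
    rw [lp.single_apply_ne _ _ _ hm, h0]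

theorem l1Rep_add (A B : lp (fun _ : Fin d → ℕ => C₀(X, ℂ)) 1) :
    l1Rep φ ρ (A + B) = l1Rep φ ρ A + l1Rep φ ρ B := by
  rw [l1Rep, l1Rep, l1Rep, ← (l1Rep_summable φ ρ A).tsum_add (l1Rep_summable φ ρ B)]
  exact tsum_congr fun n => by rw [lp.coeFn_add, Pi.add_apply, mono_add]

theorem l1Rep_smul (c : ℂ) (A : lp (fun _ : Fin d → ℕ => C₀(X, ℂ)) 1) :
    l1Rep φ ρ (c • A) = c • l1Rep φ ρ A := by
  rw [l1Rep, l1Rep, ← (l1Rep_summable φ ρ A).tsum_const_smul]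
  exact tsum_congr fun n => by rw [lp.coeFn_smul, Pi.smul_apply, mono_smul]

/-- The algebra of trigonometric polynomials, i.e. of finite sums of monomials `π (U_n f)`. -/
def trigPoly : NonUnitalSubalgebra ℂ (Fock d H₀ →L[ℂ] Fock d H₀) where
  toAddSubmonoid :=
    (Submodule.span ℂ (Set.range fun p : (Fin d → ℕ) × C₀(X, ℂ) =>
      mono φ ρ p.1 p.2)).toAddSubmonoid
  smul_mem' c _ h := Submodule.smul_mem _ c h
  mul_mem' := by
    intro a b ha hb
    change a ∈ Submodule.span ℂ _ at ha
    change b ∈ Submodule.span ℂ _ at hb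
    change a * b ∈ Submodule.span ℂ _
    induction ha using Submodule.span_induction with
    | zero => simp
    | add x y _ _ hx hy => rw [add_mul]; exact Submodule.add_mem _ hx hy
    | smul c x _ hx => rw [smul_mul_assoc]; exact Submodule.smul_mem _ c hx
    | mem x hx =>
      obtain ⟨⟨n, f⟩, rfl⟩ := hx
      induction hb using Submodule.span_induction with
      | zero => simp
      | add x y _ _ hx hy => rw [mul_add]; exact Submodule.add_mem _ hx hy
      | smul c x _ hx => rw [mul_smul_comm]; exact Submodule.smul_mem _ c hx
      | mem x hx =>
        obtain ⟨⟨m, g⟩, rfl⟩ := hx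
        exact Submodule.subset_span ⟨(n + m, φ.α m f * g), (mono_mul φ ρ n m f g).symm⟩

theorem mono_mem_trigPoly (n : Fin d → ℕ) (f : C₀(X, ℂ)) : mono φ ρ n f ∈ trigPoly φ ρ :=
  Submodule.subset_span ⟨(n, f), rfl⟩

theorem closure_range_l1Rep :
    closure (Set.range (l1Rep φ ρ)) = (trigPoly φ ρ).topologicalClosure := by
  refine subset_antisymm ?_ ?_
  · refine closure_minimal ?_ (NonUnitalSubalgebra.isClosed_topologicalClosure _)
    rintro _ ⟨A, rfl⟩
    refine mem_closure_of_tendsto (l1Rep_summable φ ρ A).hasSum (Eventually.of_forall fun s => ?_)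
    exact sum_mem fun n _ => mono_mem_trigPoly φ ρ n (A n)
  · refine closure_mono fun a ha => ?_
    change a ∈ Submodule.span ℂ _ at ha
    induction ha using Submodule.span_induction with
    | zero => exact ⟨0, by simpa using l1Rep_smul φ ρ 0 0⟩
    | add x y _ _ hx hy =>
      obtain ⟨A, rfl⟩ := hx
      obtain ⟨B, rfl⟩ := hy
      exact ⟨A + B, l1Rep_add φ ρ A B⟩
    | smul c x _ hx =>
      obtain ⟨A, rfl⟩ := hx
      exact ⟨c • A, l1Rep_smul φ ρ c A⟩
    | mem x hx =>
      obtain ⟨⟨n, f⟩, rfl⟩ := hx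
      exact ⟨lp.single 1 n f, l1Rep_single φ ρ n f⟩

/-- The analytic crossed product `C₀(X) ×_φ ℤ₊ᵈ`: the norm closure in `B(H₀ ⊗ ℓ²(ℤ₊ᵈ))` of the
image of `ℓ¹(ℤ₊ᵈ, C₀(X))` under `π`, an algebra of operators (in general without unit). -/
def crossedProduct : NonUnitalSubalgebra ℂ (Fock d H₀ →L[ℂ] Fock d H₀) where
  carrier := closure (Set.range (l1Rep φ ρ))
  zero_mem' := by rw [closure_range_l1Rep]; exact zero_mem (trigPoly φ ρ).topologicalClosure
  add_mem' := by rw [closure_range_l1Rep]; exact add_mem (S := NonUnitalSubalgebra _ _)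
  mul_mem' := by rw [closure_range_l1Rep]; exact mul_mem (S := NonUnitalSubalgebra _ _)
  smul_mem' c _ := by
    rw [closure_range_l1Rep]; exact (trigPoly φ ρ).topologicalClosure.smul_mem' c

end monomials

/-! ## Radicals of complex algebras, not assumed to be unital -/

section radicals

universe u

variable (A : Type u) [NonUnitalRing A] [Module ℂ A]

/-- An (algebraically) irreducible representation of `A` on a vector space `E`: it is not zero and
`E` has no invariant linear subspaces other than `0` and `E`. -/
def IsIrreducibleRep {A : Type u} [NonUnitalRing A] [Module ℂ A] {E : Type*} [AddCommGroup E]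
    [Module ℂ E] (σ : A →ₙₐ[ℂ] Module.End ℂ E) : Prop :=
  (∃ a, σ a ≠ 0) ∧
    ∀ W : Submodule ℂ E, (∀ a, ∀ w ∈ W, σ a w ∈ W) → W = ⊥ ∨ W = ⊤

/-- A two-sided ideal of the complex algebra `A`. -/
def IsTwoSidedIdeal {A : Type u} [NonUnitalRing A] [Module ℂ A] (I : Submodule ℂ A) : Prop :=
  ∀ a, ∀ x ∈ I, a * x ∈ I ∧ x * a ∈ I

/-- A primitive ideal of `A`: the kernel of an irreducible representation. Such a representation
is cyclic, so, up to equivalence, it acts on a quotient space of `A`, and the universe of `A` is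
large enough for `E`. -/
def IsPrimitiveIdeal {A : Type u} [NonUnitalRing A] [Module ℂ A] (P : Submodule ℂ A) : Prop :=
  ∃ (E : Type u) (_ : AddCommGroup E) (_ : Module ℂ E) (σ : A →ₙₐ[ℂ] Module.End ℂ E),
    IsIrreducibleRep σ ∧ ∀ a, a ∈ P ↔ σ a = 0

/-- A prime ideal of `A`: a proper ideal `P` such that `J₁ J₂ ⊆ P` implies `J₁ ⊆ P` or `J₂ ⊆ P`,
for all ideals `J₁`, `J₂`. -/
def IsPrimeIdeal {A : Type u} [NonUnitalRing A] [Module ℂ A] (P : Submodule ℂ A) : Prop :=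
  IsTwoSidedIdeal P ∧ P ≠ ⊤ ∧
    ∀ J₁ J₂ : Submodule ℂ A, IsTwoSidedIdeal J₁ → IsTwoSidedIdeal J₂ →
      (∀ x ∈ J₁, ∀ y ∈ J₂, x * y ∈ P) → J₁ ≤ P ∨ J₂ ≤ P

/-- The Jacobson radical: the intersection of all primitive ideals (all of `A` if there are
none). -/
def jacobsonRadical : Submodule ℂ A := sInf {P | IsPrimitiveIdeal P}

/-- The prime radical: the intersection of all prime ideals (all of `A` if there are none). -/
def primeRadical : Submodule ℂ A := sInf {P | IsPrimeIdeal P}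

/-- `A` is semisimple: its Jacobson radical is zero. -/
def IsSemisimple : Prop := jacobsonRadical A = ⊥

/-- `A` is semiprime: its prime radical is zero. -/
def IsSemiprime : Prop := primeRadical A = ⊥

end radicals

end AnalyticCrossedProduct

end

/-!
Write `A = C₀(X) ×_φ ℤ₊ᵈ` and `U_n f` for the monomials `mono φ ρ n f`, which multiply by
`(U_n f) (U_m g) = U_{n+m} ((f ∘ φ_m) g)`.

If the strongly recurrent points are not dense, Baire's theorem yields a nonempty open set `W` and a
time `b` such that `φ_n W` misses `W` for all `n ≥ b`
(`DynSystem.exists_isOpen_forall_map_notMem`). If `f ≠ 0` vanishes off `W`, then `a = U_b f` satisfies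
`a A a = 0`, so `a` is a nonzero element of every prime ideal
(`mem_primeRadical_of_mul_mul_eq_zero`), and `A` is not semiprime.

A primitive ideal is prime, so semisimple algebras are semiprime.

Suppose finally that the strongly recurrent points are dense and that the Jacobson radical contains
some `a ≠ 0`. The radical is closed (`mem_jacobsonRadical_of_mem_closure`) and invariant under the
gauge action of the torus, `U_n f ↦ tⁿ U_n f`. Averaging over roots of unity puts every monomial
`U_p f` of the Fourier series of `a` into the radical (`mono_mem_jacobsonRadical`), and one of them is
nonzero (`exists_entry_zero_ne_zero`). Let `x` be strongly recurrent with `f x ≠ 0`. For suitable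
functions `h`, `q` the product `g = (h ∘ φ_p) f q` is nonnegative and exceeds `1` at `x`, and for all
times `n k ≥ p` the element `b = ∑ 2⁻ᵏ⁻¹ U_{n k} g` is in the ideal generated by `U_p f`, hence in the
radical, hence quasinilpotent (`tendsto_norm_pow_of_mem_jacobsonRadical`). Strong recurrence allows a
choice of `n k` for which orbits starting near `x` visit `{g > 1}` along the words `w₁ = n₀`,
`wₖ₊₁ = wₖ nₖ wₖ` (`DynSystem.IsStronglyRecurrent.exists_return_words`). The letter `nₖ` has weight
`2⁻ᵏ⁻¹` but occurs in `w_l` only `2ˡ⁻¹⁻ᵏ` times, so the product of the weights along `w_l` decays only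
exponentially in its length. Since all coefficients are nonnegative, no cancellation takes place, and
`‖bᴺ‖ ≥ 16⁻ᴺ` for `N = 2ˡ - 1` (`exists_le_norm_pow`), a contradiction.
-/

noncomputable section

namespace AnalyticCrossedProduct

/-! ### Radicals of complex algebras -/

section Radicals

universe u

variable {A : Type u} [NonUnitalRing A] [Module ℂ A]

theorem mem_jacobsonRadical {a : A} :
    a ∈ jacobsonRadical A ↔ ∀ P : Submodule ℂ A, IsPrimitiveIdeal P → a ∈ P := by
  simp [jacobsonRadical, Submodule.mem_sInf]

theorem mem_primeRadical {a : A} :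
    a ∈ primeRadical A ↔ ∀ P : Submodule ℂ A, IsPrimeIdeal P → a ∈ P := by
  simp [primeRadical, Submodule.mem_sInf]

namespace IsIrreducibleRep

variable {E : Type*} [AddCommGroup E] [Module ℂ E] {σ : A →ₙₐ[ℂ] Module.End ℂ E}

theorem eq_zero_of_forall (h : IsIrreducibleRep σ) {v : E} (hv : ∀ a, σ a v = 0) : v = 0 := by
  let W : Submodule ℂ E :=
    { carrier := {w | ∀ a, σ a w = 0}
      add_mem' := fun hx hy a => by rw [map_add, hx a, hy a, add_zero]
      zero_mem' := fun a => map_zero _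
      smul_mem' := fun c x hx a => by rw [map_smul, hx a, smul_zero] }
  have hW : ∀ a, ∀ w ∈ W, σ a w ∈ W := fun a w hw b => by rw [hw a, map_zero]
  rcases h.2 W hW with h0 | h1
  · have : v ∈ W := hv
    simpa [h0] using this
  · obtain ⟨a, ha⟩ := h.1
    refine absurd (LinearMap.ext fun w => ?_) ha
    have : w ∈ W := h1 ▸ Submodule.mem_top
    exact this a

/-- Every nonzero vector of an irreducible representation is cyclic. -/
theorem exists_apply_eq (h : IsIrreducibleRep σ) {v : E} (hv : v ≠ 0) (w : E) :
    ∃ a, σ a v = w := by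
  let W : Submodule ℂ E :=
    { carrier := {w | ∃ a, σ a v = w}
      add_mem' := by
        rintro _ _ ⟨a, rfl⟩ ⟨b, rfl⟩
        exact ⟨a + b, by rw [map_add, LinearMap.add_apply]⟩
      zero_mem' := ⟨0, by rw [map_zero, LinearMap.zero_apply]⟩
      smul_mem' := by
        rintro c _ ⟨a, rfl⟩
        exact ⟨c • a, by rw [map_smul, LinearMap.smul_apply]⟩ }
  have hW : ∀ a, ∀ w ∈ W, σ a w ∈ W := by
    rintro a _ ⟨b, rfl⟩
    exact ⟨a * b, by rw [map_mul, Module.End.mul_apply]⟩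
  rcases h.2 W hW with h0 | h1
  · refine absurd (h.eq_zero_of_forall fun a => ?_) hv
    have : σ a v ∈ W := ⟨a, rfl⟩
    simpa [h0] using this
  · have : w ∈ W := h1 ▸ Submodule.mem_top
    exact this

theorem comp_surjective (h : IsIrreducibleRep σ) {γ : A →ₙₐ[ℂ] A}
    (hγ : Function.Surjective γ) : IsIrreducibleRep (σ.comp γ) := by
  refine ⟨?_, fun W hW => h.2 W fun a w hw => ?_⟩
  · obtain ⟨a, ha⟩ := h.1
    obtain ⟨b, rfl⟩ := hγ a
    exact ⟨b, ha⟩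
  · obtain ⟨b, rfl⟩ := hγ a
    exact hW b w hw

end IsIrreducibleRep

theorem IsPrimitiveIdeal.isTwoSidedIdeal {P : Submodule ℂ A} (hP : IsPrimitiveIdeal P) :
    IsTwoSidedIdeal P := by
  obtain ⟨E, _, _, σ, -, hσ⟩ := hP
  intro a x hx
  rw [hσ] at hx
  simp [hσ, hx]

theorem IsPrimitiveIdeal.isPrimeIdeal {P : Submodule ℂ A} (hP : IsPrimitiveIdeal P) :
    IsPrimeIdeal P := by
  refine ⟨hP.isTwoSidedIdeal, ?_, ?_⟩ <;> obtain ⟨E, _, _, σ, hirr, hσ⟩ := hP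
  · rintro rfl
    obtain ⟨a, ha⟩ := hirr.1
    exact ha ((hσ a).1 Submodule.mem_top)
  · intro J₁ J₂ _ h₂ h
    refine or_iff_not_imp_right.2 fun hJ x hx => ?_
    obtain ⟨y, hy, hyP⟩ := Set.not_subset.1 hJ
    obtain ⟨v, hv⟩ : ∃ v, σ y v ≠ 0 := by
      by_contra! hcon
      exact hyP ((hσ y).2 (LinearMap.ext hcon))
    -- the vectors `σ (b y) v` with `b y ∈ J₂` fill the whole space, and `x` kills them
    refine (hσ x).2 (LinearMap.ext fun w => ?_)
    obtain ⟨b, rfl⟩ := hirr.exists_apply_eq hv w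
    have := (hσ _).1 (h x hx (b * y) (h₂ b y hy).1)
    simpa using LinearMap.congr_fun this v

theorem primeRadical_le_jacobsonRadical : primeRadical A ≤ jacobsonRadical A :=
  fun _ ha => mem_jacobsonRadical.2 fun P hP => mem_primeRadical.1 ha P hP.isPrimeIdeal

theorem mul_mem_jacobsonRadical_left (b : A) {a : A} (ha : a ∈ jacobsonRadical A) :
    b * a ∈ jacobsonRadical A :=
  mem_jacobsonRadical.2 fun P hP => (hP.isTwoSidedIdeal b a (mem_jacobsonRadical.1 ha P hP)).1

theorem mul_mem_jacobsonRadical_right (b : A) {a : A} (ha : a ∈ jacobsonRadical A) :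
    a * b ∈ jacobsonRadical A :=
  mem_jacobsonRadical.2 fun P hP => (hP.isTwoSidedIdeal b a (mem_jacobsonRadical.1 ha P hP)).2

theorem map_mem_jacobsonRadical {γ : A →ₙₐ[ℂ] A} (hγ : Function.Surjective γ) {a : A}
    (ha : a ∈ jacobsonRadical A) : γ a ∈ jacobsonRadical A := by
  refine mem_jacobsonRadical.2 fun P ⟨E, i₁, i₂, σ, hirr, hσ⟩ => (hσ _).2 ?_
  let Q : Submodule ℂ A := LinearMap.ker (σ.comp γ : A →ₗ[ℂ] Module.End ℂ E)
  exact mem_jacobsonRadical.1 ha Q ⟨E, i₁, i₂, σ.comp γ, hirr.comp_surjective hγ, fun b => Iff.rfl⟩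

variable [IsScalarTower ℂ A A] [SMulCommClass ℂ A A]

/-- An element `a` with `a A a = 0` lies in every prime ideal, even in the absence of a unit. -/
theorem mem_primeRadical_of_mul_mul_eq_zero {a : A} (ha : ∀ b, a * b * a = 0) :
    a ∈ primeRadical A := by
  refine mem_primeRadical.2 fun P hP => ?_
  let L : Submodule ℂ A :=
    { carrier := {x | ∀ y, a * y * x = 0}
      add_mem' := fun hx hy b => by rw [mul_add, hx b, hy b, add_zero]
      zero_mem' := fun b => mul_zero _
      smul_mem' := fun c x hx b => by rw [mul_smul_comm, hx b, smul_zero] }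
  let R : Submodule ℂ A :=
    { carrier := {z | ∀ y, ∀ x ∈ L, z * y * x = 0}
      add_mem' := fun hx hy b w hw => by rw [add_mul, add_mul, hx b w hw, hy b w hw, add_zero]
      zero_mem' := fun b w hw => by rw [zero_mul, zero_mul]
      smul_mem' := fun c x hx b w hw => by rw [smul_mul_assoc, smul_mul_assoc, hx b w hw, smul_zero] }
  let K : Submodule ℂ A :=
    { carrier := {x | ∀ z ∈ R, z * x = 0}
      add_mem' := fun hx hy z hz => by rw [mul_add, hx z hz, hy z hz, add_zero]
      zero_mem' := fun z hz => mul_zero _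
      smul_mem' := fun c x hx z hz => by rw [mul_smul_comm, hx z hz, smul_zero] }
  have hL : IsTwoSidedIdeal L := fun b x hx =>
    ⟨fun y => by rw [← mul_assoc, mul_assoc a y b, hx], fun y => by rw [← mul_assoc, hx, zero_mul]⟩
  have hR : IsTwoSidedIdeal R := fun b z hz =>
    ⟨fun y x hx => by rw [mul_assoc b, mul_assoc b, hz y x hx, mul_zero],
      fun y x hx => by rw [mul_assoc z, hz _ x hx]⟩
  have hK : IsTwoSidedIdeal K := fun b x hx =>
    ⟨fun z hz => by rw [← mul_assoc, hx _ (hR b z hz).2],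
      fun z hz => by rw [← mul_assoc, hx z hz, zero_mul]⟩
  have hRK : R ≤ P ∨ K ≤ P := hP.2.2 R K hR hK fun z hz x hx => by
    rw [hx z hz]; exact P.zero_mem
  rcases hRK with h | h
  · exact h fun y x hx => hx y
  · have hT : IsTwoSidedIdeal (⊤ : Submodule ℂ A) := fun _ _ _ => ⟨trivial, trivial⟩
    rcases hP.2.2 ⊤ L hT hL fun b _ x hx => h fun z hz => by
      rw [← mul_assoc, hz b x hx] with h' | h'
    · exact absurd (top_le_iff.1 h') hP.2.1
    · exact h' ha

/-- Elements of the Jacobson radical are left quasi-regular. Otherwise the modular left ideal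
`{x - x b}` omits `b`, a left ideal `M` containing it and maximal with this property is a maximal
left ideal, and `b` acts nontrivially on `A ⧸ M`. -/
theorem exists_sub_mul_eq_of_mem_jacobsonRadical {b : A} (hb : b ∈ jacobsonRadical A) :
    ∃ x, x - x * b = b := by
  by_contra! hcon
  let M₀ : Submodule ℂ A :=
    { carrier := Set.range fun x => x - x * b
      add_mem' := by
        rintro _ _ ⟨x, rfl⟩ ⟨y, rfl⟩
        exact ⟨x + y, by simp only [add_mul]; abel⟩
      zero_mem' := ⟨0, by simp⟩
      smul_mem' := by
        rintro c _ ⟨x, rfl⟩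
        exact ⟨c • x, by simp only [smul_mul_assoc, smul_sub]⟩ }
  let S : Set (Submodule ℂ A) := {M | (∀ a, ∀ x ∈ M, a * x ∈ M) ∧ M₀ ≤ M ∧ b ∉ M}
  have hM₀ : M₀ ∈ S := by
    refine ⟨?_, le_rfl, ?_⟩
    · rintro a _ ⟨x, rfl⟩
      exact ⟨a * x, by simp only [mul_sub, mul_assoc]⟩
    · rintro ⟨x, hx⟩
      exact hcon x hx
  obtain ⟨M, -, hM⟩ := zorn_le_nonempty₀ S (fun c hcS hc y hy => by
    refine ⟨sSup c, ⟨fun a x hx => ?_, ?_, fun hbc => ?_⟩, fun z hz => le_sSup hz⟩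
    · obtain ⟨N, hN, hxN⟩ := (Submodule.mem_sSup_of_directed ⟨y, hy⟩ hc.directedOn).1 hx
      exact (Submodule.mem_sSup_of_directed ⟨y, hy⟩ hc.directedOn).2 ⟨N, hN, (hcS hN).1 a x hxN⟩
    · exact (hcS hy).2.1.trans (le_sSup hy)
    · obtain ⟨N, hN, hbN⟩ := (Submodule.mem_sSup_of_directed ⟨y, hy⟩ hc.directedOn).1 hbc
      exact (hcS hN).2.2 hbN) M₀ hM₀
  obtain ⟨hMl, hM₀M, hbM⟩ := hM.prop
  have hmod : ∀ x, x - x * b ∈ M := fun x => hM₀M ⟨x, rfl⟩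
  let σ : A →ₙₐ[ℂ] Module.End ℂ (A ⧸ M) :=
    { toFun := fun a => M.mapQ M (LinearMap.mulLeft ℂ a) fun x hx => hMl a x hx
      map_smul' := fun c a => LinearMap.ext fun w => by
        obtain ⟨x, rfl⟩ := M.mkQ_surjective w
        exact congrArg M.mkQ (smul_mul_assoc c a x)
      map_zero' := LinearMap.ext fun w => by
        obtain ⟨x, rfl⟩ := M.mkQ_surjective w
        exact congrArg M.mkQ (zero_mul x)
      map_add' := fun a a' => LinearMap.ext fun w => by
        obtain ⟨x, rfl⟩ := M.mkQ_surjective w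
        exact congrArg M.mkQ (add_mul a a' x)
      map_mul' := fun a a' => LinearMap.ext fun w => by
        obtain ⟨x, rfl⟩ := M.mkQ_surjective w
        exact congrArg M.mkQ (mul_assoc a a' x) }
  have hσ : ∀ a x, σ a (M.mkQ x) = M.mkQ (a * x) := fun a x => rfl
  have hσb : σ b ≠ 0 := fun h => by
    have h1 : M.mkQ (b * b) = 0 := by rw [← hσ, h, LinearMap.zero_apply]
    have h2 : b * b ∈ M := by simpa using h1
    exact hbM (by simpa using M.add_mem (hmod b) h2)
  refine hσb ?_
  have hirr : IsIrreducibleRep σ := by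
    refine ⟨⟨b, hσb⟩, fun W hW => or_iff_not_imp_right.2 fun hWtop => ?_⟩
    have hN : W.comap M.mkQ ∈ S := by
      refine ⟨fun a x hx => ?_, fun x hx => ?_, fun hbW => hWtop ?_⟩
      · exact hW a _ hx
      · have : M.mkQ x = 0 := by simpa using hM₀M hx
        rw [Submodule.mem_comap, this]
        exact W.zero_mem
      · -- a left ideal containing the right modular unit `b` is everything
        refine eq_top_iff.2 fun w _ => ?_
        obtain ⟨x, rfl⟩ := M.mkQ_surjective w
        have h1 : M.mkQ (x - x * b) = 0 := (Submodule.Quotient.mk_eq_zero M).2 (hmod x)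
        rw [map_sub, sub_eq_zero] at h1
        rw [h1, ← hσ]
        exact hW x _ hbW
    have hle : M ≤ W.comap M.mkQ := fun x hx => by
      have : M.mkQ x = 0 := by simpa using hx
      rw [Submodule.mem_comap, this]
      exact W.zero_mem
    have hge : W.comap M.mkQ ≤ M := hM.le_of_ge hN hle
    refine eq_bot_iff.2 fun w hw => ?_
    obtain ⟨x, rfl⟩ := M.mkQ_surjective w
    have : M.mkQ x = 0 := by simpa using hge hw
    rw [this]; exact Submodule.zero_mem _
  exact mem_jacobsonRadical.1 hb (LinearMap.ker (σ : A →ₗ[ℂ] Module.End ℂ (A ⧸ M)))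
    ⟨A ⧸ M, _, _, σ, hirr, fun a => Iff.rfl⟩

end Radicals

/-! ### The Jacobson radical of a closed subalgebra of a Banach algebra -/

section Banach

/-- If `b` is in the radical of a subalgebra, then `1 - b` is invertible in the whole algebra: a left
quasi-inverse of `b` is in the radical too, so it has a left quasi-inverse itself. -/
theorem isUnit_one_sub_of_mem_jacobsonRadical {R : Type*} [Ring R] [Algebra ℂ R]
    (S : NonUnitalSubalgebra ℂ R) {b : S} (hb : b ∈ jacobsonRadical S) :
    IsUnit (1 - (b : R)) := by
  obtain ⟨x, hx⟩ := exists_sub_mul_eq_of_mem_jacobsonRadical hb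
  have hxr : x ∈ jacobsonRadical S := by
    rw [eq_add_of_sub_eq hx]
    exact Submodule.add_mem _ hb (mul_mem_jacobsonRadical_left x hb)
  obtain ⟨y, hy⟩ := exists_sub_mul_eq_of_mem_jacobsonRadical (Submodule.neg_mem _ hxr)
  have hx' : (x : R) - x * b = b := by exact_mod_cast congrArg Subtype.val hx
  have hy' : (y : R) - y * (-x) = -x := by exact_mod_cast congrArg Subtype.val hy
  have h1 : (1 + (x : R)) * (1 - b) = 1 := by
    have : (1 + (x : R)) * (1 - b) = 1 + (x - x * b) - b := by noncomm_ring
    rw [this, hx', add_sub_cancel_right]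
  have h2 : (1 + (y : R)) * (1 + x) = 1 := by
    have : (1 + (y : R)) * (1 + x) = 1 + (y - y * (-x)) + x := by noncomm_ring
    rw [this, hy', neg_add_cancel_right]
  have h3 : (1 : R) - b = 1 + y := (left_inv_eq_right_inv h2 h1).symm
  exact ⟨⟨1 - b, 1 + x, by rw [h3, h2], h1⟩, rfl⟩

variable {R : Type*} [NormedRing R] [NormedAlgebra ℂ R] [CompleteSpace R]

/-- Elements of the Jacobson radical are quasinilpotent. -/
theorem tendsto_norm_pow_of_mem_jacobsonRadical (S : NonUnitalSubalgebra ℂ R) {b : S}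
    (hb : b ∈ jacobsonRadical S) :
    Tendsto (fun n : ℕ => ‖(b : R) ^ n‖ ^ (1 / n : ℝ)) atTop (𝓝 0) := by
  have hsp : spectralRadius ℂ (b : R) = 0 := by
    refine le_antisymm (iSup₂_le fun z hz => ?_) bot_le
    by_contra hz0
    have hz0' : z ≠ 0 := fun h => hz0 (by simp [h])
    refine hz ?_
    have h := isUnit_one_sub_of_mem_jacobsonRadical S (Submodule.smul_mem _ z⁻¹ hb)
    have h' : algebraMap ℂ R z - b = z • (1 - ((z⁻¹ • b : S) : R)) := by
      rw [smul_sub, NonUnitalSubalgebra.coe_smul, smul_smul, mul_inv_cancel₀ hz0', one_smul,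
        Algebra.algebraMap_eq_smul_one]
    rw [spectrum.mem_resolventSet_iff, h', Algebra.smul_def]
    exact ((IsUnit.mk0 z hz0').map (algebraMap ℂ R)).mul h
  have h := spectrum.pow_norm_pow_one_div_tendsto_nhds_spectralRadius (b : R)
  rw [hsp] at h
  have h2 := (ENNReal.tendsto_toReal ENNReal.zero_ne_top).comp h
  simp only [ENNReal.toReal_zero] at h2
  refine h2.congr fun n => ?_
  simp only [Function.comp]
  rw [ENNReal.toReal_ofReal (by positivity)]

/-- The Jacobson radical of a Banach algebra is closed: if `σ (b) v ≠ 0` in an irreducible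
representation, then `σ (y b) v = v` for some `y`; approximating `b` by `c` in the radical yields
`q = y (b - c)` of norm less than `1` with `σ (q) v = v`, while `1 - q` is invertible. -/
theorem mem_jacobsonRadical_of_mem_closure (S : NonUnitalSubalgebra ℂ R)
    (hS : IsClosed (S : Set R)) {b : S}
    (hb : ∀ ε > 0, ∃ c ∈ jacobsonRadical S, ‖(b : R) - c‖ < ε) : b ∈ jacobsonRadical S := by
  refine mem_jacobsonRadical.2 fun P ⟨E, i₁, i₂, σ, hirr, hσ⟩ =>
    (hσ _).2 (LinearMap.ext fun v => ?_)
  by_contra hv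
  have hv0 : v ≠ 0 := fun h => hv (by rw [h, map_zero, map_zero])
  obtain ⟨y, hy⟩ := hirr.exists_apply_eq hv v
  obtain ⟨c, hc, hbc⟩ := hb (1 / (‖(y : R)‖ + 1)) (by positivity)
  have hcP : σ c = 0 := (hσ c).1 (mem_jacobsonRadical.1 hc P ⟨E, i₁, i₂, σ, hirr, hσ⟩)
  set q : S := y * (b - c) with hq
  have hqn : ‖(q : R)‖ < 1 := by
    calc ‖(q : R)‖ ≤ ‖(y : R)‖ * ‖(b : R) - c‖ := norm_mul_le _ _
      _ ≤ ‖(y : R)‖ * (1 / (‖(y : R)‖ + 1)) := by gcongr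
      _ < 1 := by
        rw [mul_one_div, div_lt_one (by positivity)]
        exact lt_add_one _
  have hqv : σ q v = v := by
    rw [hq, map_mul, Module.End.mul_apply, map_sub, hcP, sub_zero, hy]
  have hsum : Summable fun n : ℕ => (q : R) ^ n := summable_geometric_of_norm_lt_one hqn
  have hpow : ∀ n : ℕ, (q : R) ^ (n + 1) ∈ S := fun n => by
    induction n with
    | zero => simp
    | succ n ih => rw [pow_succ]; exact S.mul_mem ih q.2
  have hxS : ∑' n : ℕ, (q : R) ^ (n + 1) ∈ S :=
    hS.mem_of_tendsto ((summable_nat_add_iff 1).2 hsum).hasSum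
      (Eventually.of_forall fun s => sum_mem fun n _ => hpow n)
  let x : S := ⟨_, hxS⟩
  have hx : x - x * q = q := by
    refine Subtype.ext ?_
    change (∑' n : ℕ, (q : R) ^ (n + 1)) - (∑' n : ℕ, (q : R) ^ (n + 1)) * q = q
    have h1 := (summable_nat_add_iff 1).2 hsum
    rw [← h1.tsum_mul_right]
    simp only [← pow_succ]
    rw [h1.tsum_eq_zero_add]
    simp
  have h1 : σ (x - x * q) v = 0 := by
    rw [map_sub, map_mul, LinearMap.sub_apply, Module.End.mul_apply, hqv, sub_self]
  rw [hx, hqv] at h1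
  exact hv0 h1

end Banach

variable {d : ℕ} {X : Type*} [TopologicalSpace X]
variable {H₀ : Type*} [NormedAddCommGroup H₀] [InnerProductSpace ℂ H₀]

theorem isTopologicalRing_of_normedRing (R : Type*) [NormedRing R] : IsTopologicalRing R :=
  inferInstance

-- instance search does not identify the topology of `E →L[ℂ] E` with that of its norm here
instance : IsTopologicalRing (Fock d H₀ →L[ℂ] Fock d H₀) :=
  isTopologicalRing_of_normedRing (Fock d H₀ →L[ℂ] Fock d H₀)


/-! ### Matrix entries and Fourier coefficients -/

section Entries

/-- The `(m, k)` entry `H₀ → H₀` of an operator on `H₀ ⊗ ℓ²(ℤ₊ᵈ)`: it sends `v` to the coordinate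
at `m` of the image of `v ⊗ e k`. The entry with `k = 0` serves as the `m`-th Fourier
coefficient. -/
def entry (k m : Fin d → ℕ) : (Fock d H₀ →L[ℂ] Fock d H₀) →L[ℂ] (H₀ →L[ℂ] H₀) :=
  (ContinuousLinearMap.compL ℂ H₀ (Fock d H₀) H₀
      (lp.evalCLM ℂ (fun _ : Fin d → ℕ => H₀) 2 m)).comp
    ((ContinuousLinearMap.compL ℂ H₀ (Fock d H₀) (Fock d H₀)).flip
      (lp.singleContinuousLinearMap ℂ (fun _ : Fin d → ℕ => H₀) 2 k))

theorem entry_apply (k m : Fin d → ℕ) (A : Fock d H₀ →L[ℂ] Fock d H₀) (v : H₀) :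
    entry k m A v = A (lp.single 2 k v) m := rfl

theorem norm_entry_le (k m : Fin d → ℕ) (A : Fock d H₀ →L[ℂ] Fock d H₀) :
    ‖entry k m A‖ ≤ ‖A‖ := by
  refine ContinuousLinearMap.opNorm_le_bound _ (norm_nonneg A) fun v => ?_
  rw [entry_apply]
  refine (lp.norm_apply_le_norm (by norm_num) _ _).trans ((A.le_opNorm _).trans_eq ?_)
  rw [lp.norm_single (by norm_num)]

theorem eq_zero_of_entry_eq_zero {A : Fock d H₀ →L[ℂ] Fock d H₀} (h : ∀ k m, entry k m A = 0) :
    A = 0 := by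
  refine lp.ext_continuousLinearMap (by norm_num) fun k => ContinuousLinearMap.ext fun v => ?_
  ext m
  have := DFunLike.congr_fun (h k m) v
  rw [entry_apply] at this
  simpa using this

variable [CompleteSpace H₀] (φ : DynSystem d X) (ρ : C₀(X, ℂ) →⋆ₙₐ[ℂ] (H₀ →L[ℂ] H₀))

theorem DynSystem.α_zero (f : C₀(X, ℂ)) : φ.α 0 f = f := by
  ext x
  simp [φ.map_zero]

theorem entry_mono (k n : Fin d → ℕ) (f : C₀(X, ℂ)) :
    entry k (k + n) (mono φ ρ n f) = ρ (φ.α k f) := by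
  ext v
  rw [entry_apply, mono_single, lp.single_apply_self]

theorem entry_mono_of_ne {k n m : Fin d → ℕ} (h : m ≠ k + n) (f : C₀(X, ℂ)) :
    entry k m (mono φ ρ n f) = 0 := by
  ext v
  rw [entry_apply, mono_single, lp.single_apply_ne _ _ _ h]
  rfl

theorem mem_crossedProduct {A : Fock d H₀ →L[ℂ] Fock d H₀} :
    A ∈ crossedProduct φ ρ ↔ A ∈ closure (trigPoly φ ρ : Set (Fock d H₀ →L[ℂ] Fock d H₀)) := by
  change A ∈ closure (Set.range (l1Rep φ ρ)) ↔ _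
  rw [closure_range_l1Rep]
  rfl

theorem isClosed_crossedProduct :
    IsClosed (crossedProduct φ ρ : Set (Fock d H₀ →L[ℂ] Fock d H₀)) := isClosed_closure

theorem trigPoly_le_crossedProduct : trigPoly φ ρ ≤ crossedProduct φ ρ := fun _ h =>
  (mem_crossedProduct φ ρ).2 (subset_closure h)

theorem mono_mem_crossedProduct (n : Fin d → ℕ) (f : C₀(X, ℂ)) :
    mono φ ρ n f ∈ crossedProduct φ ρ :=
  trigPoly_le_crossedProduct φ ρ (mono_mem_trigPoly φ ρ n f)

theorem mono_zero (n : Fin d → ℕ) : mono φ ρ n (0 : C₀(X, ℂ)) = 0 := by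
  simpa using mono_smul φ ρ n 0 0

theorem trigPoly_induction {p : (Fock d H₀ →L[ℂ] Fock d H₀) → Prop}
    (mono : ∀ n f, p (mono φ ρ n f)) (zero : p 0) (add : ∀ A B, p A → p B → p (A + B))
    (smul : ∀ (c : ℂ) A, p A → p (c • A)) {A : Fock d H₀ →L[ℂ] Fock d H₀}
    (hA : A ∈ trigPoly φ ρ) : p A := by
  change A ∈ Submodule.span ℂ _ at hA
  induction hA using Submodule.span_induction with
  | zero => exact zero
  | add x y _ _ hx hy => exact add x y hx hy
  | smul c x _ hx => exact smul c x hx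
  | mem x hx =>
    obtain ⟨q, rfl⟩ := hx
    exact mono q.1 q.2

theorem exists_entry_eq_of_mem_trigPoly {A : Fock d H₀ →L[ℂ] Fock d H₀} (hA : A ∈ trigPoly φ ρ)
    (n : Fin d → ℕ) : ∃ f, ∀ k, entry k (k + n) A = ρ (φ.α k f) := by
  refine trigPoly_induction φ ρ (p := fun A => ∃ f, ∀ k, entry k (k + n) A = ρ (φ.α k f))
    (fun m f => ?_) ⟨0, fun k => ?_⟩ ?_ ?_ hA
  · by_cases h : n = m
    · subst h
      exact ⟨f, fun k => entry_mono φ ρ k n f⟩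
    · refine ⟨0, fun k => ?_⟩
      rw [entry_mono_of_ne φ ρ (by simpa using h)]
      exact (map_zero ρ).symm
  · rw [map_zero]
    exact (map_zero ρ).symm
  · rintro A B ⟨f, hf⟩ ⟨g, hg⟩
    exact ⟨f + g, fun k => by rw [map_add, hf, hg, φ.α_add, map_add]⟩
  · rintro c A ⟨f, hf⟩
    exact ⟨c • f, fun k => by rw [map_smul, hf, φ.α_smul, map_smul]⟩

theorem entry_eq_zero_of_not_le {A : Fock d H₀ →L[ℂ] Fock d H₀} (hA : A ∈ crossedProduct φ ρ)
    {k m : Fin d → ℕ} (h : ¬ k ≤ m) : entry k m A = 0 := by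
  rw [mem_crossedProduct] at hA
  refine closure_minimal (t := {A | entry k m A = 0}) (fun P hP => ?_)
    (isClosed_eq (entry k m).continuous continuous_const) hA
  refine trigPoly_induction φ ρ (p := fun A => entry k m A = 0) (fun n f => ?_) (map_zero _)
    (fun A B hA hB => ?_) (fun c A hA => ?_) hP
  · refine entry_mono_of_ne φ ρ ?_ f
    rintro rfl
    exact h le_self_add
  · rw [map_add, hA, hB, add_zero]
  · rw [map_smul, hA, smul_zero]

variable {ρ} (hρ : Function.Injective ρ)
include hρ

theorem norm_rho (f : C₀(X, ℂ)) : ‖ρ f‖ = ‖f‖ := NonUnitalStarAlgHom.norm_map ρ hρ f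

theorem isometry_rho : Isometry ρ :=
  AddMonoidHomClass.isometry_of_norm ρ (norm_rho hρ)

/-- The entries of an element of the crossed product are dominated by its Fourier coefficients: for a
trigonometric polynomial with coefficients `f_n`, the entry `(k + n, k)` is `ρ (f_n ∘ φ_k)`. -/
theorem norm_entry_le_norm_entry_zero {A : Fock d H₀ →L[ℂ] Fock d H₀}
    (hA : A ∈ crossedProduct φ ρ) (k n : Fin d → ℕ) :
    ‖entry k (k + n) A‖ ≤ ‖entry 0 n A‖ := by
  rw [mem_crossedProduct] at hA
  refine closure_minimal (t := {A | ‖entry k (k + n) A‖ ≤ ‖entry 0 n A‖}) (fun P hP => ?_)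
    (isClosed_le (entry k (k + n)).continuous.norm (entry 0 n).continuous.norm) hA
  obtain ⟨f, hf⟩ := exists_entry_eq_of_mem_trigPoly φ ρ hP n
  have h0 := hf 0
  rw [zero_add, φ.α_zero] at h0
  change ‖_‖ ≤ ‖_‖
  rw [hf k, h0, norm_rho hρ, norm_rho hρ]
  exact φ.norm_α_le k f

/-- The Fourier coefficients of an element of the crossed product are functions in `C₀(X)`. -/
theorem exists_entry_zero_eq {A : Fock d H₀ →L[ℂ] Fock d H₀}
    (hA : A ∈ crossedProduct φ ρ) (n : Fin d → ℕ) : ∃ f, entry 0 n A = ρ f := by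
  rw [mem_crossedProduct] at hA
  have hcl : IsClosed (Set.range ρ) := (isometry_rho hρ).isClosedEmbedding.isClosed_range
  have := closure_minimal (t := (entry 0 n) ⁻¹' Set.range ρ) (fun P hP => ?_)
    (hcl.preimage (entry 0 n).continuous) hA
  · obtain ⟨f, hf⟩ := this
    exact ⟨f, hf.symm⟩
  · obtain ⟨f, hf⟩ := exists_entry_eq_of_mem_trigPoly φ ρ hP n
    refine ⟨f, ?_⟩
    rw [← φ.α_zero f, ← hf 0, zero_add]

/-- A nonzero element of the crossed product has a nonzero Fourier coefficient. -/
theorem exists_entry_zero_ne_zero {A : Fock d H₀ →L[ℂ] Fock d H₀}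
    (hA : A ∈ crossedProduct φ ρ) (h0 : A ≠ 0) : ∃ n f, f ≠ 0 ∧ entry 0 n A = ρ f := by
  by_contra! hcon
  refine h0 (eq_zero_of_entry_eq_zero fun k m => ?_)
  by_cases h : k ≤ m
  · obtain ⟨n, rfl⟩ := exists_add_of_le h
    obtain ⟨f, hf⟩ := exists_entry_zero_eq φ hρ hA n
    have hf0 : f = 0 := by
      by_contra hne
      exact hcon n f hne hf
    have := norm_entry_le_norm_entry_zero φ hρ hA k n
    rw [hf, hf0, map_zero, norm_zero] at this
    exact norm_le_zero_iff.1 this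
  · exact entry_eq_zero_of_not_le φ ρ hA h

theorem mono_ne_zero (n : Fin d → ℕ) {f : C₀(X, ℂ)} (hf : f ≠ 0) : mono φ ρ n f ≠ 0 := by
  intro h
  have h1 := entry_mono φ ρ 0 n f
  rw [h, map_zero, φ.α_zero] at h1
  exact hf (hρ (by rw [← h1, map_zero]))

end Entries

/-! ### The gauge action of the torus -/

section Gauge

/-- The character `k ↦ ∏ⱼ tⱼ ^ kⱼ` of `ℤ₊ᵈ` given by a point `t` of the torus. -/
def torusChar (t : Fin d → Circle) (k : Fin d → ℕ) : Circle := ∏ j, t j ^ k j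

theorem torusChar_add (t : Fin d → Circle) (k n : Fin d → ℕ) :
    torusChar t (k + n) = torusChar t k * torusChar t n := by
  simp [torusChar, pow_add, Finset.prod_mul_distrib]

theorem torusChar_inv (t : Fin d → Circle) (k : Fin d → ℕ) :
    torusChar t⁻¹ k = (torusChar t k)⁻¹ := by
  simp [torusChar]

theorem norm_torusChar_smul (t : Fin d → Circle) (ξ : (Fin d → ℕ) → H₀) (k : Fin d → ℕ) :
    ‖(torusChar t k : ℂ) • ξ k‖ = ‖ξ k‖ := by
  rw [norm_smul, Circle.norm_coe, one_mul]

theorem memℓp_torusChar_smul (t : Fin d → Circle) (ξ : Fock d H₀) :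
    Memℓp (fun k => (torusChar t k : ℂ) • ξ k) 2 := by
  refine memℓp_gen ?_
  simp only [norm_torusChar_smul]
  exact (lp.memℓp ξ).summable (by norm_num)

/-- The diagonal unitary of `H₀ ⊗ ℓ²(ℤ₊ᵈ)` multiplying the coordinate at `k` by the value at `k` of
the character `t`. -/
def torusDiag (t : Fin d → Circle) : Fock d H₀ →L[ℂ] Fock d H₀ :=
  LinearMap.mkContinuous
    { toFun := fun ξ => ⟨fun k => (torusChar t k : ℂ) • ξ k, memℓp_torusChar_smul t ξ⟩
      map_add' := fun ξ η => Subtype.ext (funext fun m => smul_add _ (ξ m) (η m))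
      map_smul' := fun c ξ => Subtype.ext (funext fun m => smul_comm _ c (ξ m)) }
    1 fun ξ => by
      refine lp.norm_le_of_tsum_le (by norm_num) (by positivity) ?_
      have h := lp.norm_rpow_eq_tsum (p := 2) (by norm_num) ξ
      rw [one_mul, h]
      exact (tsum_congr fun k => by rw [← norm_torusChar_smul t ξ k]; rfl).le

theorem torusDiag_apply (t : Fin d → Circle) (ξ : Fock d H₀) (k : Fin d → ℕ) :
    torusDiag t ξ k = (torusChar t k : ℂ) • ξ k := rfl

theorem norm_torusDiag_le (t : Fin d → Circle) :
    ‖(torusDiag t : Fock d H₀ →L[ℂ] Fock d H₀)‖ ≤ 1 :=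
  LinearMap.mkContinuous_norm_le _ zero_le_one _

theorem torusDiag_inv_mul (t : Fin d → Circle) :
    (torusDiag t⁻¹ * torusDiag t : Fock d H₀ →L[ℂ] Fock d H₀) = 1 := by
  ext ξ k
  change (torusDiag t⁻¹ (torusDiag t ξ)) k = ξ k
  rw [torusDiag_apply, torusDiag_apply, smul_smul, torusChar_inv, ← Circle.coe_mul,
    inv_mul_cancel, Circle.coe_one, one_smul]

/-- Conjugation by the diagonal unitary of `t`: the gauge automorphism. -/
def gauge (t : Fin d → Circle) (A : Fock d H₀ →L[ℂ] Fock d H₀) : Fock d H₀ →L[ℂ] Fock d H₀ :=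
  torusDiag t * A * torusDiag t⁻¹

theorem gauge_mul (t : Fin d → Circle) (A B : Fock d H₀ →L[ℂ] Fock d H₀) :
    gauge t (A * B) = gauge t A * gauge t B := by
  have h : gauge t A * gauge t B =
      torusDiag t * A * (torusDiag t⁻¹ * torusDiag t) * B * torusDiag t⁻¹ := by
    simp only [gauge, mul_assoc]
  rw [h, torusDiag_inv_mul, mul_one, gauge, mul_assoc (torusDiag t) A B]

theorem gauge_add (t : Fin d → Circle) (A B : Fock d H₀ →L[ℂ] Fock d H₀) :
    gauge t (A + B) = gauge t A + gauge t B := by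
  simp only [gauge, mul_add, add_mul]

theorem gauge_zero (t : Fin d → Circle) :
    gauge t (0 : Fock d H₀ →L[ℂ] Fock d H₀) = 0 := by
  simp only [gauge, mul_zero, zero_mul]

theorem gauge_smul (t : Fin d → Circle) (c : ℂ) (A : Fock d H₀ →L[ℂ] Fock d H₀) :
    gauge t (c • A) = c • gauge t A := by
  simp only [gauge, mul_smul_comm, smul_mul_assoc]

theorem gauge_gauge_inv (t : Fin d → Circle) (A : Fock d H₀ →L[ℂ] Fock d H₀) :
    gauge t (gauge t⁻¹ A) = A := by
  have h := torusDiag_inv_mul (H₀ := H₀) t⁻¹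
  rw [inv_inv] at h
  have h' : gauge t (gauge t⁻¹ A) =
      (torusDiag t * torusDiag t⁻¹) * A * (torusDiag t * torusDiag t⁻¹) := by
    simp only [gauge, mul_assoc, inv_inv]
  rw [h', h, one_mul, mul_one]

theorem norm_gauge_le (t : Fin d → Circle) (A : Fock d H₀ →L[ℂ] Fock d H₀) :
    ‖gauge t A‖ ≤ ‖A‖ := by
  have h1 := norm_torusDiag_le (H₀ := H₀) t
  have h2 := norm_torusDiag_le (H₀ := H₀) t⁻¹
  calc ‖gauge t A‖ ≤ ‖(torusDiag t : Fock d H₀ →L[ℂ] Fock d H₀)‖ * ‖A‖ *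
        ‖(torusDiag t⁻¹ : Fock d H₀ →L[ℂ] Fock d H₀)‖ := by
        unfold gauge
        exact (ContinuousLinearMap.opNorm_comp_le _ _).trans
          (mul_le_mul_of_nonneg_right (ContinuousLinearMap.opNorm_comp_le _ _) (norm_nonneg _))
    _ ≤ 1 * ‖A‖ * 1 := by gcongr
    _ = ‖A‖ := by ring

theorem continuous_gauge (t : Fin d → Circle) :
    Continuous (gauge t : (Fock d H₀ →L[ℂ] Fock d H₀) → _) := by
  exact (continuous_const.mul continuous_id).mul continuous_const

variable [CompleteSpace H₀] (φ : DynSystem d X) (ρ : C₀(X, ℂ) →⋆ₙₐ[ℂ] (H₀ →L[ℂ] H₀))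

theorem gauge_mono (t : Fin d → Circle) (n : Fin d → ℕ) (f : C₀(X, ℂ)) :
    gauge t (mono φ ρ n f) = (torusChar t n : ℂ) • mono φ ρ n f := by
  ext ξ m
  change torusDiag t (mono φ ρ n f (torusDiag t⁻¹ ξ)) m = (torusChar t n : ℂ) • mono φ ρ n f ξ m
  rw [torusDiag_apply, mono_apply, mono_apply]
  by_cases h : n ≤ m
  · obtain ⟨k, rfl⟩ : ∃ k, m = k + n := ⟨m - n, (tsub_add_cancel_of_le h).symm⟩
    rw [monoFun_add_apply, monoFun_add_apply, torusDiag_apply, map_smul, smul_smul,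
      torusChar_add, torusChar_inv, ← Circle.coe_mul, mul_right_comm, mul_inv_cancel, one_mul]
  · rw [monoFun_eq_zero φ ρ n f _ h, monoFun_eq_zero φ ρ n f _ h, smul_zero, smul_zero]

theorem gauge_mem_crossedProduct (t : Fin d → Circle) {A : Fock d H₀ →L[ℂ] Fock d H₀}
    (hA : A ∈ crossedProduct φ ρ) : gauge t A ∈ crossedProduct φ ρ := by
  rw [mem_crossedProduct] at hA ⊢
  refine map_mem_closure (continuous_gauge t) hA fun P hP => ?_
  refine trigPoly_induction φ ρ (p := fun P => gauge t P ∈ trigPoly φ ρ) (fun n f => ?_) ?_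
    (fun A B hA hB => ?_) (fun c A hA => ?_) hP
  · rw [gauge_mono]
    exact (trigPoly φ ρ).smul_mem' _ (mono_mem_trigPoly φ ρ n f)
  · rw [gauge_zero]
    exact (trigPoly φ ρ).zero_mem
  · rw [gauge_add]
    exact (trigPoly φ ρ).add_mem hA hB
  · rw [gauge_smul]
    exact (trigPoly φ ρ).smul_mem' c hA

/-- The gauge automorphism given by a point of the torus, as a homomorphism of algebras. -/
def gaugeHom (t : Fin d → Circle) :
    (Fock d H₀ →L[ℂ] Fock d H₀) →ₙₐ[ℂ] (Fock d H₀ →L[ℂ] Fock d H₀) where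
  toFun := gauge t
  map_smul' := gauge_smul t
  map_zero' := gauge_zero t
  map_add' := gauge_add t
  map_mul' := gauge_mul t

/-- The restriction of a gauge automorphism to the crossed product. -/
def crossedGaugeHom (t : Fin d → Circle) : crossedProduct φ ρ →ₙₐ[ℂ] crossedProduct φ ρ :=
  NonUnitalAlgHom.codRestrict
    ((gaugeHom t).comp (NonUnitalSubalgebraClass.subtype (crossedProduct φ ρ))) (crossedProduct φ ρ)
    fun A => gauge_mem_crossedProduct φ ρ t A.2

theorem coe_crossedGaugeHom (t : Fin d → Circle) (A : crossedProduct φ ρ) :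
    (crossedGaugeHom φ ρ t A : Fock d H₀ →L[ℂ] Fock d H₀) = gauge t A := rfl

theorem crossedGaugeHom_surjective (t : Fin d → Circle) :
    Function.Surjective (crossedGaugeHom φ ρ t) := fun A =>
  ⟨crossedGaugeHom φ ρ t⁻¹ A, Subtype.ext (gauge_gauge_inv t (A : Fock d H₀ →L[ℂ] Fock d H₀))⟩

end Gauge

/-! ### Averaging over roots of unity -/

section Averages

/-- The point of the torus whose coordinates are the powers of `exp (2πi / N)` with exponents
`a`. -/
def rootPoint {N : ℕ} (a : Fin d → Fin N) : Fin d → Circle :=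
  fun j => Circle.exp (2 * Real.pi / N) ^ (a j : ℕ)

theorem isPrimitiveRoot_coe_circleExp {N : ℕ} (hN : N ≠ 0) :
    IsPrimitiveRoot (Circle.exp (2 * Real.pi / N) : ℂ) N := by
  have h := Complex.isPrimitiveRoot_exp N hN
  convert h using 1
  rw [Circle.coe_exp]
  push_cast
  ring_nf

theorem sum_torusChar_rootPoint {N : ℕ} {m n : Fin d → ℕ} (hm : ∀ j, m j < N)
    (hn : ∀ j, n j < N) :
    ∑ a : Fin d → Fin N, (torusChar (rootPoint a) n : ℂ)⁻¹ * torusChar (rootPoint a) m =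
      if m = n then (N : ℂ) ^ d else 0 := by
  set z : Fin d → ℂ := fun j => ((Circle.exp (2 * Real.pi / N) : ℂ) ^ n j)⁻¹ *
    (Circle.exp (2 * Real.pi / N) : ℂ) ^ m j with hz
  have h1 : ∀ a : Fin d → Fin N,
      (torusChar (rootPoint a) n : ℂ)⁻¹ * torusChar (rootPoint a) m = ∏ j, z j ^ (a j : ℕ) := by
    intro a
    have h0 : ∀ k : Fin d → ℕ, (torusChar (rootPoint a) k : ℂ) =
        ∏ j, ((Circle.exp (2 * Real.pi / N) : ℂ) ^ k j) ^ (a j : ℕ) := fun k => by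
      refine (map_prod Circle.coeHom _ _).trans (Finset.prod_congr rfl fun j _ => ?_)
      exact pow_right_comm (Circle.exp (2 * Real.pi / N) : ℂ) _ _
    rw [h0, h0, ← Finset.prod_inv_distrib, ← Finset.prod_mul_distrib]
    simp only [hz, mul_pow, inv_pow]
  have h2 : ∏ j, ∑ i : Fin N, z j ^ (i : ℕ) = ∑ a : Fin d → Fin N, ∏ j, z j ^ (a j : ℕ) := by
    rw [Finset.prod_univ_sum, Fintype.piFinset_univ]
  rw [Finset.sum_congr rfl fun a _ => h1 a, ← h2]
  split_ifs with h
  · subst h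
    have hz1 : ∀ j, z j = 1 := fun j =>
      inv_mul_cancel₀ (pow_ne_zero _ (Circle.coe_ne_zero _))
    simp [hz1]
  · obtain ⟨j, hj⟩ := Function.ne_iff.1 h
    refine Finset.prod_eq_zero (Finset.mem_univ j) ?_
    have hN : N ≠ 0 := (Nat.zero_le _).trans_lt (hm j) |>.ne'
    have hprim := isPrimitiveRoot_coe_circleExp hN
    have hzj : z j - 1 ≠ 0 := fun h0 => hj <| by
      refine hprim.pow_inj (hm j) (hn j) ?_
      rw [sub_eq_zero, hz] at h0
      exact ((inv_mul_eq_one₀ (pow_ne_zero _ (Circle.coe_ne_zero _))).1 h0).symm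
    have hzN : z j ^ N = 1 := by
      rw [hz]
      simp only [mul_pow, inv_pow, ← pow_mul]
      rw [mul_comm (n j), mul_comm (m j), pow_mul, pow_mul, hprim.pow_eq_one]
      simp
    rw [Fin.sum_univ_eq_sum_range (fun i => z j ^ i) N]
    have h3 := mul_geom_sum (z j) N
    rw [hzN, sub_self] at h3
    exact (mul_eq_zero.1 h3).resolve_left hzj

/-- A gauge automorphism as a linear map. -/
def gaugeLinear (t : Fin d → Circle) :
    (Fock d H₀ →L[ℂ] Fock d H₀) →ₗ[ℂ] (Fock d H₀ →L[ℂ] Fock d H₀) where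
  toFun := gauge t
  map_add' := gauge_add t
  map_smul' := gauge_smul t

/-- The average of the gauge automorphisms over the points of the torus with coordinates `N`-th
roots of unity, weighted so as to extract the `n`-th Fourier coefficient. -/
def gaugeAvg (N : ℕ) (n : Fin d → ℕ) :
    (Fock d H₀ →L[ℂ] Fock d H₀) →ₗ[ℂ] (Fock d H₀ →L[ℂ] Fock d H₀) :=
  ((N : ℂ) ^ d)⁻¹ • ∑ a : Fin d → Fin N,
    (torusChar (rootPoint a) n : ℂ)⁻¹ • gaugeLinear (rootPoint a)

theorem gaugeAvg_apply (N : ℕ) (n : Fin d → ℕ) (A : Fock d H₀ →L[ℂ] Fock d H₀) :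
    gaugeAvg N n A = ((N : ℂ) ^ d)⁻¹ • ∑ a : Fin d → Fin N,
      (torusChar (rootPoint a) n : ℂ)⁻¹ • gauge (rootPoint a) A := by
  rw [gaugeAvg, LinearMap.smul_apply, LinearMap.sum_apply]
  rfl

theorem norm_inv_card_smul_sum_le {ι E : Type*} [Fintype ι] [NormedAddCommGroup E]
    [NormedSpace ℂ E] {c : ι → ℂ} (hc : ∀ i, ‖c i‖ = 1) {x : ι → E} {r : ℝ} (hr : 0 ≤ r)
    (hx : ∀ i, ‖x i‖ ≤ r) : ‖(Fintype.card ι : ℂ)⁻¹ • ∑ i, c i • x i‖ ≤ r := by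
  have h := norm_sum_le_of_le Finset.univ (f := fun i => c i • x i) (n := fun _ => r) fun i _ => by
    rw [norm_smul, hc, one_mul]
    exact hx i
  rw [Finset.sum_const, Finset.card_univ, nsmul_eq_mul] at h
  rw [norm_smul, norm_inv, Complex.norm_natCast]
  refine (mul_le_mul_of_nonneg_left h (by positivity)).trans ?_
  rw [← mul_assoc]
  exact mul_le_of_le_one_left hr inv_mul_le_one

theorem norm_gaugeAvg_le (N : ℕ) (n : Fin d → ℕ) (A : Fock d H₀ →L[ℂ] Fock d H₀) :
    ‖gaugeAvg N n A‖ ≤ ‖A‖ := by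
  have h := norm_inv_card_smul_sum_le (E := Fock d H₀ →L[ℂ] Fock d H₀)
    (c := fun a : Fin d → Fin N => (torusChar (rootPoint a) n : ℂ)⁻¹)
    (fun a => by rw [norm_inv, Circle.norm_coe, inv_one]) (norm_nonneg A)
    (fun a => norm_gauge_le (rootPoint a) A)
  rw [Fintype.card_fun, Fintype.card_fin, Fintype.card_fin, Nat.cast_pow] at h
  rw [gaugeAvg_apply]
  exact h

variable [CompleteSpace H₀] (φ : DynSystem d X) (ρ : C₀(X, ℂ) →⋆ₙₐ[ℂ] (H₀ →L[ℂ] H₀))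

theorem gaugeAvg_mono {N : ℕ} {m n : Fin d → ℕ} (hm : ∀ j, m j < N) (hn : ∀ j, n j < N)
    (hN : N ≠ 0) (f : C₀(X, ℂ)) :
    gaugeAvg N n (mono φ ρ m f) = if m = n then mono φ ρ m f else 0 := by
  have hN' : (N : ℂ) ^ d ≠ 0 := pow_ne_zero _ (Nat.cast_ne_zero.2 hN)
  rw [gaugeAvg_apply]
  simp only [gauge_mono, smul_smul]
  rw [← Finset.sum_smul, sum_torusChar_rootPoint hm hn, smul_smul]
  split_ifs with h
  · rw [inv_mul_cancel₀ hN', one_smul]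
  · rw [mul_zero, zero_smul]

/-- On trigonometric polynomials, averages over roots of unity of large order extract a
monomial. -/
theorem exists_eventually_gaugeAvg_eq {A : Fock d H₀ →L[ℂ] Fock d H₀} (hA : A ∈ trigPoly φ ρ)
    (n : Fin d → ℕ) :
    ∃ f, entry 0 n A = ρ f ∧ ∀ᶠ N in atTop, gaugeAvg N n A = mono φ ρ n f := by
  refine trigPoly_induction φ ρ
    (p := fun A => ∃ f, entry 0 n A = ρ f ∧ ∀ᶠ N in atTop, gaugeAvg N n A = mono φ ρ n f)
    (fun m f => ?_) ⟨0, ?_, ?_⟩ ?_ ?_ hA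
  · have hev : ∀ᶠ N in atTop, gaugeAvg N n (mono φ ρ m f) = if m = n then mono φ ρ m f else 0 := by
      have h1 : ∀ k : Fin d → ℕ, ∀ᶠ N in atTop, ∀ j, k j < N := fun k =>
        eventually_all.2 fun j => eventually_gt_atTop (k j)
      filter_upwards [h1 m, h1 n, eventually_ne_atTop 0] with N h2 h3 h4
      exact gaugeAvg_mono φ ρ h2 h3 h4 f
    by_cases h : m = n
    · subst h
      refine ⟨f, ?_, by simpa using hev⟩
      have := entry_mono φ ρ 0 m f
      rwa [zero_add, φ.α_zero] at this
    · refine ⟨0, ?_, ?_⟩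
      · rw [entry_mono_of_ne φ ρ (by rw [zero_add]; exact Ne.symm h)]
        exact (map_zero ρ).symm
      · rw [mono_zero]
        simpa [h] using hev
  · rw [map_zero]
    exact (map_zero ρ).symm
  · refine Eventually.of_forall fun N => ?_
    rw [map_zero, mono_zero]
  · rintro A B ⟨f, hf, hf'⟩ ⟨g, hg, hg'⟩
    refine ⟨f + g, by rw [map_add, map_add, hf, hg], ?_⟩
    filter_upwards [hf', hg'] with N h1 h2
    rw [map_add, h1, h2, mono_add]
  · rintro c A ⟨f, hf, hf'⟩
    refine ⟨c • f, by rw [map_smul, map_smul, hf], ?_⟩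
    filter_upwards [hf'] with N h1
    rw [map_smul, h1, mono_smul]

/-- The Jacobson radical is stable under the averages `gaugeAvg`. -/
theorem exists_coe_eq_gaugeAvg {A : crossedProduct φ ρ}
    (hA : A ∈ jacobsonRadical (crossedProduct φ ρ)) (N : ℕ) (n : Fin d → ℕ) :
    ∃ B ∈ jacobsonRadical (crossedProduct φ ρ),
      (B : Fock d H₀ →L[ℂ] Fock d H₀) = gaugeAvg N n (A : Fock d H₀ →L[ℂ] Fock d H₀) := by
  refine ⟨((N : ℂ) ^ d)⁻¹ • ∑ a : Fin d → Fin N, (torusChar (rootPoint a) n : ℂ)⁻¹ •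
    crossedGaugeHom φ ρ (rootPoint a) A, Submodule.smul_mem _ _ (Submodule.sum_mem _ fun a _ =>
      Submodule.smul_mem _ _ (map_mem_jacobsonRadical (crossedGaugeHom_surjective φ ρ _) hA)), ?_⟩
  rw [gaugeAvg_apply, NonUnitalSubalgebra.coe_smul, AddSubmonoidClass.coe_finsetSum]
  simp only [NonUnitalSubalgebra.coe_smul, coe_crossedGaugeHom]

variable {ρ} (hρ : Function.Injective ρ)
include hρ

/-- The monomials of the Fourier series of an element of the Jacobson radical are in the
radical. -/
theorem mono_mem_jacobsonRadical {A : crossedProduct φ ρ}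
    (hA : A ∈ jacobsonRadical (crossedProduct φ ρ)) {n : Fin d → ℕ} {f : C₀(X, ℂ)}
    (hf : entry 0 n (A : Fock d H₀ →L[ℂ] Fock d H₀) = ρ f) :
    (⟨mono φ ρ n f, mono_mem_crossedProduct φ ρ n f⟩ : crossedProduct φ ρ) ∈
      jacobsonRadical (crossedProduct φ ρ) := by
  refine mem_jacobsonRadical_of_mem_closure (crossedProduct φ ρ) (isClosed_crossedProduct φ ρ)
    fun ε hε => ?_
  obtain ⟨P, hP, hAP⟩ := Metric.mem_closure_iff.1 ((mem_crossedProduct φ ρ).1 A.2) (ε / 2)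
    (half_pos hε)
  rw [dist_eq_norm] at hAP
  obtain ⟨g, hg, hev⟩ := exists_eventually_gaugeAvg_eq φ ρ hP n
  obtain ⟨N, hN⟩ := hev.exists
  obtain ⟨B, hB, hBA⟩ := exists_coe_eq_gaugeAvg φ ρ hA N n
  refine ⟨B, hB, ?_⟩
  have hfg : ‖mono φ ρ n f - mono φ ρ n g‖ < ε / 2 := by
    have h1 : mono φ ρ n f - mono φ ρ n g = mono φ ρ n (f - g) := by
      rw [sub_eq_iff_eq_add, ← mono_add, sub_add_cancel]
    calc ‖mono φ ρ n f - mono φ ρ n g‖ ≤ ‖f - g‖ := by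
          rw [h1]; exact norm_mono_le φ ρ n _
      _ = ‖entry 0 n ((A : Fock d H₀ →L[ℂ] Fock d H₀) - P)‖ := by
          rw [map_sub, hf, hg, ← map_sub, norm_rho hρ]
      _ ≤ ‖(A : Fock d H₀ →L[ℂ] Fock d H₀) - P‖ := norm_entry_le _ _ _
      _ < ε / 2 := hAP
  have h2 : ‖mono φ ρ n g - gaugeAvg N n (A : Fock d H₀ →L[ℂ] Fock d H₀)‖ < ε / 2 := by
    rw [← hN, ← map_sub]
    refine (norm_gaugeAvg_le _ _ _).trans_lt ?_
    rwa [norm_sub_rev]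
  rw [hBA]
  calc _ ≤ ‖mono φ ρ n f - mono φ ρ n g‖ +
        ‖mono φ ρ n g - gaugeAvg N n (A : Fock d H₀ →L[ℂ] Fock d H₀)‖ :=
        norm_sub_le_norm_sub_add_norm_sub _ _ _
    _ < ε / 2 + ε / 2 := add_lt_add hfg h2
    _ = ε := add_halves ε

end Averages

/-! ### The cone of operators with nonnegative Fourier coefficients -/

section PositiveCone

open scoped ComplexOrder

variable [CompleteSpace H₀] (φ : DynSystem d X) (ρ : C₀(X, ℂ) →⋆ₙₐ[ℂ] (H₀ →L[ℂ] H₀))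

/-- The multiplicative semigroup of the monomials `U_n f` with `f ≥ 0`. -/
def posMono : Subsemigroup (Fock d H₀ →L[ℂ] Fock d H₀) where
  carrier := {A | ∃ n f, (∀ y, 0 ≤ f y) ∧ mono φ ρ n f = A}
  mul_mem' := by
    rintro _ _ ⟨n, f, hf, rfl⟩ ⟨m, g, hg, rfl⟩
    exact ⟨n + m, φ.α m f * g, fun y => mul_nonneg (hf _) (hg y), (mono_mul φ ρ n m f g).symm⟩

/-- The closed cone generated by the monomials `U_n f` with `f ≥ 0`. It is stable under products,
and `A ↦ A - B ∈ posCone` serves as a coefficientwise order. -/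
def posCone : NonUnitalSubsemiring (Fock d H₀ →L[ℂ] Fock d H₀) :=
  (posMono φ ρ).nonUnitalSubsemiringClosure.topologicalClosure

theorem mono_mem_posCone (n : Fin d → ℕ) {f : C₀(X, ℂ)} (hf : ∀ y, 0 ≤ f y) :
    mono φ ρ n f ∈ posCone φ ρ :=
  subset_closure (AddSubmonoid.subset_closure ⟨n, f, hf, rfl⟩)

/-- A convergent series in the cone dominates each of its terms. -/
theorem sub_mem_posCone_of_hasSum {T : ℕ → (Fock d H₀ →L[ℂ] Fock d H₀)}
    {B : Fock d H₀ →L[ℂ] Fock d H₀} (hB : HasSum T B) (hT : ∀ k, T k ∈ posCone φ ρ) (k : ℕ) :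
    B - T k ∈ posCone φ ρ := by
  have h := hB.update k 0
  rw [zero_sub, neg_add_eq_sub] at h
  refine (NonUnitalSubsemiring.isClosed_topologicalClosure _).mem_of_tendsto h
    (Eventually.of_forall fun s => sum_mem fun i _ => ?_)
  by_cases hi : i = k
  · rw [hi, Function.update_self]
    exact zero_mem (posCone φ ρ)
  · rw [Function.update_of_ne hi]
    exact hT i

theorem isClosed_setOf_nonneg : IsClosed {f : C₀(X, ℂ) | ∀ y, 0 ≤ f y} := by
  rw [ofPred_forall]
  refine isClosed_iInter fun y => ?_
  have hc : Continuous fun f : C₀(X, ℂ) => f y :=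
    (continuous_eval_const (F := BoundedContinuousFunction X ℂ) y).comp ZeroAtInftyContinuousMap.isometry_toBCF.continuous
  exact isClosed_le continuous_const hc

variable {ρ} (hρ : Function.Injective ρ)
include hρ

theorem exists_nonneg_entry_eq {A : Fock d H₀ →L[ℂ] Fock d H₀} (hA : A ∈ posCone φ ρ)
    (n : Fin d → ℕ) : ∃ f, (∀ y, 0 ≤ f y) ∧ entry 0 n A = ρ f := by
  have hcl : IsClosed (ρ '' {f : C₀(X, ℂ) | ∀ y, 0 ≤ f y}) :=
    (isometry_rho hρ).isClosedEmbedding.isClosedMap _ isClosed_setOf_nonneg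
  have hsub : ((posMono φ ρ).nonUnitalSubsemiringClosure : Set (Fock d H₀ →L[ℂ] Fock d H₀)) ⊆
      entry 0 n ⁻¹' (ρ '' {f : C₀(X, ℂ) | ∀ y, 0 ≤ f y}) := by
    intro P hP
    change P ∈ AddSubmonoid.closure _ at hP
    induction hP using AddSubmonoid.closure_induction with
    | mem P hP =>
      obtain ⟨m, f, hf, rfl⟩ := hP
      by_cases h : n = m
      · subst h
        refine ⟨f, hf, ?_⟩
        have := entry_mono φ ρ 0 n f
        rw [zero_add, φ.α_zero] at this
        exact this.symm
      · refine ⟨0, fun y => le_rfl, ?_⟩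
        rw [entry_mono_of_ne φ ρ (by rwa [zero_add]), map_zero]
    | zero => exact ⟨0, fun y => le_rfl, by rw [map_zero, map_zero]⟩
    | add P Q _ _ hP hQ =>
      obtain ⟨f, hf, hfP⟩ := hP
      obtain ⟨g, hg, hgQ⟩ := hQ
      exact ⟨f + g, fun y => add_nonneg (hf y) (hg y), by rw [map_add, map_add, hfP, hgQ]⟩
  obtain ⟨f, hf, hfA⟩ := closure_minimal hsub (hcl.preimage (entry 0 n).continuous) hA
  exact ⟨f, hf, hfA.symm⟩

/-- Coefficientwise lower bounds by nonnegative monomials are lower bounds for the norm. -/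
theorem le_norm_of_sub_mono_mem_posCone {A : Fock d H₀ →L[ℂ] Fock d H₀} {n : Fin d → ℕ}
    {f : C₀(X, ℂ)} (hA : A - mono φ ρ n f ∈ posCone φ ρ) {r : ℝ} {x : X} (hr : (r : ℂ) ≤ f x) :
    r ≤ ‖A‖ := by
  obtain ⟨g, hg, hgA⟩ := exists_nonneg_entry_eq φ hρ hA n
  have hm := entry_mono φ ρ 0 n f
  rw [zero_add, φ.α_zero] at hm
  rw [map_sub, sub_eq_iff_eq_add, hm, ← map_add] at hgA
  have h1 : (r : ℂ) ≤ (g + f) x := hr.trans (le_add_of_nonneg_left (hg x))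
  calc r ≤ ((g + f) x).re := (Complex.le_def.1 h1).1
    _ ≤ ‖(g + f) x‖ := Complex.re_le_norm _
    _ ≤ ‖g + f‖ := by
      rw [← ZeroAtInftyContinuousMap.norm_toBCF_eq_norm]
      exact (g + f).toBCF.norm_coe_le_norm x
    _ = ‖entry 0 n A‖ := by rw [hgA, norm_rho hρ]
    _ ≤ ‖A‖ := norm_entry_le _ _ _

end PositiveCone

/-! ### Returns of a strongly recurrent point -/

section Returns

theorem DynSystem.IsStronglyRecurrent.exists_le_map_mem {φ : DynSystem d X} {x : X}
    (hx : φ.IsStronglyRecurrent x) {W : Set X} (hW : W ∈ 𝓝 x) (b : Fin d → ℕ) :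
    ∃ m, b ≤ m ∧ φ.map m x ∈ W := by
  obtain ⟨n, hn, hnx⟩ := hx
  have h1 : ∀ᶠ k in atTop, ∀ j, b j ≤ k := eventually_all.2 fun j => eventually_ge_atTop (b j)
  obtain ⟨k, hk1, hk2⟩ := (h1.and (hnx.eventually_mem hW)).exists
  exact ⟨n k, fun j => (hk1 j).trans ((hn j (mem_univ j)).le_apply), hk2⟩

/-- Around a strongly recurrent point `x` of an open set `V` there are steps `n k`, as large as
desired, and neighbourhoods `W k` of `x` such that an orbit starting in `W k` is in `V` at the times
given by the partial sums of the word `w k`, where `w 0` is empty and `w (k + 1)` is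
`w k, n k, w k`. Here `s k` is the sum of the word `w k`. -/
theorem DynSystem.IsStronglyRecurrent.exists_return_words {φ : DynSystem d X} {x : X}
    (hx : φ.IsStronglyRecurrent x) {V : Set X} (hV : IsOpen V) (hxV : x ∈ V) (p : Fin d → ℕ) :
    ∃ (n s : ℕ → (Fin d → ℕ)) (W : ℕ → Set X), s 0 = 0 ∧ (∀ k, p ≤ n k) ∧
      (∀ k, s (k + 1) = s k + n k + s k) ∧ (∀ k, x ∈ W k) ∧ (∀ k, W k ⊆ V) ∧
      (∀ k, MapsTo (φ.map (s k)) (W k) V) ∧ (∀ k, W (k + 1) ⊆ W k) ∧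
      ∀ k, MapsTo (φ.map (s k + n k)) (W (k + 1)) (W k) := by
  let State := {q : (Fin d → ℕ) × Set X //
    IsOpen q.2 ∧ x ∈ q.2 ∧ q.2 ⊆ V ∧ MapsTo (φ.map q.1) q.2 V}
  have step : ∀ q : State, ∃ (q' : State) (n : Fin d → ℕ), p ≤ n ∧ q'.1.1 = q.1.1 + n + q.1.1 ∧
      q'.1.2 ⊆ q.1.2 ∧ MapsTo (φ.map (q.1.1 + n)) q'.1.2 q.1.2 := by
    rintro ⟨⟨s, W⟩, hWo, hxW, hWV, hsW⟩
    obtain ⟨m, hm, hmx⟩ := hx.exists_le_map_mem (hWo.mem_nhds hxW) (s + p)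
    obtain ⟨n, rfl⟩ := exists_add_of_le (le_self_add.trans hm : s ≤ m)
    refine ⟨⟨⟨s + n + s, W ∩ φ.map (s + n) ⁻¹' W⟩,
      hWo.inter (hWo.preimage (φ.isProperMap _).continuous), ⟨hxW, hmx⟩,
      inter_subset_left.trans hWV, ?_⟩, n, le_of_add_le_add_left hm, rfl, inter_subset_left,
      fun y hy => hy.2⟩
    intro y hy
    dsimp only
    rw [add_comm (s + n) s, φ.map_add]
    exact hsW hy.2
  choose next n hn hs hW hmaps using step
  let q₀ : State := ⟨⟨0, V⟩, hV, hxV, le_rfl, by simp [φ.map_zero, MapsTo]⟩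
  let q : ℕ → State := fun k => Nat.rec q₀ (fun _ => next) k
  exact ⟨fun k => n (q k), fun k => (q k).1.1, fun k => (q k).1.2, rfl, fun k => hn _,
    fun k => hs _, fun k => (q k).2.2.1, fun k => (q k).2.2.2.1, fun k => (q k).2.2.2.2,
    fun k => hW _, fun k => hmaps _⟩

end Returns

/-! ### A lower bound for norms of powers -/

section Powers

open scoped ComplexOrder

variable [CompleteSpace H₀] (φ : DynSystem d X) {ρ : C₀(X, ℂ) →⋆ₙₐ[ℂ] (H₀ →L[ℂ] H₀)}

theorem mul_mul_sub_mul_mul_mem {R : Type*} [NonUnitalRing R] {C : NonUnitalSubsemiring R}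
    {P M B T : R} (hM : M ∈ C) (hT : T ∈ C) (hPM : P - M ∈ C) (hBT : B - T ∈ C) :
    P * B * P - M * T * M ∈ C := by
  have hP : P ∈ C := by simpa using add_mem hPM hM
  have hB : B ∈ C := by simpa using add_mem hBT hT
  have h : P * B * P - M * T * M = (P - M) * B * P + M * (B - T) * P + M * T * (P - M) := by
    noncomm_ring
  rw [h]
  exact add_mem (add_mem (mul_mem (mul_mem hPM hB) hP) (mul_mem (mul_mem hM hBT) hP))
    (mul_mem (mul_mem hM hT) hPM)

/-- The sum `∑ 2⁻ᵏ⁻¹ U_{n k} g`, for `g ≥ 0` and the steps `n k` of `exists_return_words`, is not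
quasinilpotent: in its power of exponent `2ᵏ⁺¹ - 1`, the term that belongs to the word `w (k + 1)` is
large at `x`, and no other term can cancel it since all coefficients are nonnegative. -/
theorem exists_le_norm_pow (hρ : Function.Injective ρ) {g : C₀(X, ℂ)} (hg : ∀ y, 0 ≤ g y)
    {n s : ℕ → (Fin d → ℕ)} {W : ℕ → Set X} {x : X} (hs0 : s 0 = 0)
    (hs : ∀ k, s (k + 1) = s k + n k + s k) (hx : ∀ k, x ∈ W k) (hWg : ∀ k, ∀ y ∈ W k, 1 ≤ g y)
    (hsW : ∀ k, ∀ y ∈ W k, 1 ≤ g (φ.map (s k) y)) (hW : ∀ k, W (k + 1) ⊆ W k)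
    (hmaps : ∀ k, MapsTo (φ.map (s k + n k)) (W (k + 1)) (W k))
    {B : Fock d H₀ →L[ℂ] Fock d H₀}
    (hB : HasSum (fun k => mono φ ρ (n k) ((2⁻¹ : ℂ) ^ (k + 1) • g)) B) (k : ℕ) :
    (1 / 16 : ℝ) ^ (2 ^ (k + 1) - 1) ≤ ‖B ^ (2 ^ (k + 1) - 1)‖ := by
  have h2 : (0 : ℂ) ≤ 2⁻¹ := by
    rw [inv_nonneg]; exact zero_le_two
  have hgk : ∀ k y, 0 ≤ ((2⁻¹ : ℂ) ^ (k + 1) • g) y := fun k y =>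
    mul_nonneg (pow_nonneg h2 _) (hg y)
  have hT : ∀ k, mono φ ρ (n k) ((2⁻¹ : ℂ) ^ (k + 1) • g) ∈ posCone φ ρ := fun k =>
    mono_mem_posCone φ ρ _ (hgk k)
  have hBT := sub_mem_posCone_of_hasSum φ ρ hB hT
  -- `2⁻ᵉ` is the product of the weights along the word `w (k + 1)`
  have key : ∀ k : ℕ, ∃ (e : ℕ) (G : C₀(X, ℂ)), e + k + 3 = 2 ^ (k + 2) ∧ (∀ y, 0 ≤ G y) ∧
      (∀ y ∈ W (k + 1), (2⁻¹ : ℂ) ^ e ≤ G y) ∧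
      B ^ (2 ^ (k + 1) - 1) - mono φ ρ (s (k + 1)) G ∈ posCone φ ρ := by
    intro k
    induction k with
    | zero =>
      refine ⟨1, (2⁻¹ : ℂ) ^ (0 + 1) • g, by norm_num, hgk 0, fun y hy => ?_, ?_⟩
      · exact le_mul_of_one_le_right (pow_nonneg h2 _) (hWg _ y hy)
      · have h := hBT 0
        have hn : s (0 + 1) = n 0 := by rw [hs, hs0, zero_add, add_zero]
        rw [hn]
        simpa using h
    | succ k ih =>
      obtain ⟨e, G, he, hG, hGW, hBG⟩ := ih
      refine ⟨e + (k + 1 + 1) + e,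
        φ.α (s (k + 1)) (φ.α (n (k + 1)) G * ((2⁻¹ : ℂ) ^ (k + 1 + 1) • g)) * G, ?_, ?_, ?_, ?_⟩
      · rw [pow_succ, ← he]; ring
      · exact fun y => mul_nonneg (mul_nonneg (hG _) (hgk _ _)) (hG y)
      · intro y hy
        have h1 : (2⁻¹ : ℂ) ^ e ≤ G (φ.map (n (k + 1)) (φ.map (s (k + 1)) y)) := by
          have := hGW _ (hmaps (k + 1) hy)
          rwa [add_comm, φ.map_add] at this
        have h3 : (2⁻¹ : ℂ) ^ (k + 1 + 1) ≤ ((2⁻¹ : ℂ) ^ (k + 1 + 1) • g) (φ.map (s (k + 1)) y) :=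
          le_mul_of_one_le_right (pow_nonneg h2 _) (hsW (k + 1) y (hW _ hy))
        have h4 := hGW y (hW _ hy)
        rw [pow_add, pow_add]
        exact mul_le_mul (mul_le_mul h1 h3 (pow_nonneg h2 _) (hG _)) h4 (pow_nonneg h2 _)
          (mul_nonneg (hG _) (hgk _ _))
      · have hL : 2 ^ (k + 1 + 1) - 1 = (2 ^ (k + 1) - 1) + 1 + (2 ^ (k + 1) - 1) := by
          have : 0 < 2 ^ (k + 1) := by positivity
          rw [pow_succ 2 (k + 1)]
          omega
        rw [hL, pow_add, pow_succ, hs (k + 1), ← mono_mul, ← mono_mul]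
        exact mul_mul_sub_mul_mul_mem (mono_mem_posCone φ ρ _ hG) (hT (k + 1)) hBG (hBT (k + 1))
  obtain ⟨e, G, he, -, hGW, hBG⟩ := key k
  have h5 : (((2⁻¹ : ℝ) ^ e : ℝ) : ℂ) ≤ G x := by
    have := hGW x (hx _)
    push_cast
    exact this
  refine le_trans ?_ (le_norm_of_sub_mono_mem_posCone φ hρ hBG h5)
  have h6 : (1 / 16 : ℝ) = (2⁻¹) ^ 4 := by norm_num
  rw [h6, ← pow_mul]
  refine pow_le_pow_of_le_one (by norm_num) (by norm_num) ?_
  have : 2 ^ (k + 2) = 2 * 2 ^ (k + 1) := by ring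
  have : 2 ≤ 2 ^ (k + 1) := by
    rw [pow_succ]
    exact Nat.le_mul_of_pos_left 2 (by positivity)
  omega

end Powers

/-! ### Density of the strongly recurrent points implies semisimplicity -/

section Semisimple

open scoped ComplexOrder

theorem exists_zeroAtInfty_eq_one [R1Space X] [LocallyCompactSpace X] {U : Set X} (hU : IsOpen U)
    {x : X} (hx : x ∈ U) :
    ∃ f : C₀(X, ℂ), f x = 1 ∧ (∀ y, 0 ≤ f y) ∧ ∀ y ∉ U, f y = 0 := by
  obtain ⟨f, hf1, hf0, hfc, hf⟩ := exists_continuous_one_zero_of_isCompact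
    (isCompact_singleton (x := x)) hU.isClosed_compl (by simpa using hx)
  refine ⟨⟨⟨fun y => (f y : ℂ), by fun_prop⟩, ?_⟩, ?_, fun y => ?_, fun y hy => ?_⟩
  · exact (hfc.comp_left (g := fun r : ℝ => (r : ℂ)) Complex.ofReal_zero).is_zero_at_infty
  · have : f x = 1 := hf1 rfl
    change (f x : ℂ) = 1
    rw [this, Complex.ofReal_one]
  · exact Complex.zero_le_real.2 (hf y).1
  · have : f y = 0 := hf0 hy
    change (f y : ℂ) = 0
    rw [this, Complex.ofReal_zero]

variable [CompleteSpace H₀] (φ : DynSystem d X) (ρ : C₀(X, ℂ) →⋆ₙₐ[ℂ] (H₀ →L[ℂ] H₀))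

/-- If `U_p f` is in the radical, then so is `∑ 2⁻ᵏ⁻¹ U_{n k} g` with `g = (h ∘ φ_p) f q`: it is
`(∑ 2⁻ᵏ⁻¹ U_{n k - p} h) (U_p f) (U_0 q)`. -/
theorem exists_hasSum_mem_jacobsonRadical {p : Fin d → ℕ} {f : C₀(X, ℂ)}
    (hf : (⟨mono φ ρ p f, mono_mem_crossedProduct φ ρ p f⟩ : crossedProduct φ ρ) ∈
      jacobsonRadical (crossedProduct φ ρ)) (h q : C₀(X, ℂ)) {n : ℕ → (Fin d → ℕ)}
    (hn : ∀ k, p ≤ n k) :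
    ∃ B ∈ jacobsonRadical (crossedProduct φ ρ),
      HasSum (fun k => mono φ ρ (n k) ((2⁻¹ : ℂ) ^ (k + 1) • (φ.α p h * f * q)))
        (B : Fock d H₀ →L[ℂ] Fock d H₀) := by
  have hs : Summable fun k => mono φ ρ (n k - p) ((2⁻¹ : ℂ) ^ (k + 1) • h) := by
    have h1 : Summable fun k : ℕ => (2⁻¹ : ℝ) ^ (k + 1) * ‖h‖ :=
      ((summable_nat_add_iff 1).2
        (summable_geometric_of_lt_one (by norm_num) (by norm_num))).mul_right _
    refine Summable.of_norm_bounded h1 fun k => (norm_mono_le φ ρ _ _).trans_eq ?_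
    rw [norm_smul]
    simp
  have hC : (∑' k, mono φ ρ (n k - p) ((2⁻¹ : ℂ) ^ (k + 1) • h)) ∈ crossedProduct φ ρ :=
    (isClosed_crossedProduct φ ρ).mem_of_tendsto hs.hasSum
      (Eventually.of_forall fun s => sum_mem fun k _ => mono_mem_crossedProduct φ ρ _ _)
  refine ⟨⟨_, hC⟩ * ⟨_, mono_mem_crossedProduct φ ρ p f⟩ * ⟨_, mono_mem_crossedProduct φ ρ 0 q⟩,
    mul_mem_jacobsonRadical_right _ (mul_mem_jacobsonRadical_left _ hf), ?_⟩
  have h2 := (hs.hasSum.mul_right (mono φ ρ p f)).mul_right (mono φ ρ 0 q)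
  have h3 : ∀ k, mono φ ρ (n k - p) ((2⁻¹ : ℂ) ^ (k + 1) • h) * mono φ ρ p f * mono φ ρ 0 q =
      mono φ ρ (n k) ((2⁻¹ : ℂ) ^ (k + 1) • (φ.α p h * f * q)) := fun k => by
    rw [mono_mul, mono_mul, add_zero, tsub_add_cancel_of_le (hn k), φ.α_zero, φ.α_smul,
      smul_mul_assoc, smul_mul_assoc]
  rw [funext h3] at h2
  exact h2

variable {ρ} in
theorem jacobsonRadical_eq_bot_of_dense [R1Space X] [LocallyCompactSpace X]
    (hρ : Function.Injective ρ) (hd : Dense {x : X | φ.IsStronglyRecurrent x}) :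
    jacobsonRadical (crossedProduct φ ρ) = ⊥ := by
  refine (Submodule.eq_bot_iff _).2 fun A hA => ?_
  by_contra hA0
  obtain ⟨p, f, hf0, hfA⟩ := exists_entry_zero_ne_zero φ hρ A.2 fun h => hA0 (Subtype.ext h)
  have hf := mono_mem_jacobsonRadical φ hρ hA hfA
  obtain ⟨x₀, hx₀⟩ : ∃ x, f x ≠ 0 := by
    by_contra! hcon
    exact hf0 (ZeroAtInftyContinuousMap.ext hcon)
  obtain ⟨x, hfx, hx⟩ := hd.inter_open_nonempty {y | f y ≠ 0}
    (isOpen_ne_fun f.continuous continuous_const) ⟨x₀, hx₀⟩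
  obtain ⟨h, hh1, hh, -⟩ := exists_zeroAtInfty_eq_one isOpen_univ (mem_univ (φ.map p x))
  set c : ℝ := 2 / ‖f x‖ ^ 2 with hc
  set g : C₀(X, ℂ) := φ.α p h * f * ((c : ℂ) • star f) with hgdef
  have hgy : ∀ y, g y = h (φ.map p y) * ((c * ‖f y‖ ^ 2 : ℝ) : ℂ) := by
    intro y
    have : f y * star (f y) = ((‖f y‖ ^ 2 : ℝ) : ℂ) := by
      rw [Complex.star_def, Complex.mul_conj, Complex.normSq_eq_norm_sq]
    change h (φ.map p y) * f y * ((c : ℂ) * star (f y)) = _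
    rw [Complex.ofReal_mul, ← this]
    ring
  have hg : ∀ y, 0 ≤ g y := fun y => by
    rw [hgy]
    exact mul_nonneg (hh _) (Complex.zero_le_real.2 (by positivity))
  have hgx : g x = 2 := by
    have : ‖f x‖ ≠ 0 := norm_ne_zero_iff.2 hfx
    rw [hgy, hh1, hc, one_mul, div_mul_cancel₀ _ (pow_ne_zero 2 this)]
    norm_num
  have hre : ∀ y, 1 < (g y).re → 1 ≤ g y := fun y hy =>
    Complex.le_def.2 ⟨hy.le, (Complex.le_def.1 (hg y)).2⟩
  obtain ⟨n, s, W, hs0, hpn, hs, hxW, hWV, hsW, hW, hmaps⟩ :=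
    hx.exists_return_words (V := {y | 1 < (g y).re})
      (isOpen_lt continuous_const (Complex.continuous_re.comp g.continuous))
      (by simp [hgx]) p
  obtain ⟨B, hB, hBsum⟩ := exists_hasSum_mem_jacobsonRadical φ ρ hf h ((c : ℂ) • star f) hpn
  have hlow := exists_le_norm_pow φ hρ hg hs0 hs hxW (fun k y hy => hre y (hWV k hy))
    (fun k y hy => hre _ (hsW k hy)) hW hmaps hBsum
  have hlim := tendsto_norm_pow_of_mem_jacobsonRadical (crossedProduct φ ρ) hB
  have hsub : Tendsto (fun k : ℕ => 2 ^ (k + 1) - 1) atTop atTop :=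
    tendsto_atTop_mono (fun k => Nat.le_sub_one_of_lt
      ((Nat.lt_succ_self k).trans Nat.lt_two_pow_self)) tendsto_id
  have hge := ge_of_tendsto' (hlim.comp hsub) (b := 1 / 16) fun k => by
    have hk : 2 ^ (k + 1) - 1 ≠ 0 := by
      have : 2 ≤ 2 ^ (k + 1) := by
        rw [pow_succ]
        exact Nat.le_mul_of_pos_left 2 (by positivity)
      omega
    have h1 := Real.rpow_le_rpow (by positivity) (hlow k)
      (z := (1 / ((2 ^ (k + 1) - 1 : ℕ) : ℝ))) (by positivity)
    rwa [one_div ((2 ^ (k + 1) - 1 : ℕ) : ℝ), Real.pow_rpow_inv_natCast (by norm_num) hk,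
      ← one_div] at h1
  norm_num at hge

end Semisimple

/-! ### Semiprimeness implies density of the strongly recurrent points -/

section Semiprime

/-- By Baire's theorem, if the strongly recurrent points are not dense then some nonempty open set
never returns to itself at large times. -/
theorem DynSystem.exists_isOpen_forall_map_notMem [TopologicalSpace.MetrizableSpace X]
    [LocallyCompactSpace X] (φ : DynSystem d X)
    (hd : ¬ Dense {x : X | φ.IsStronglyRecurrent x}) :
    ∃ W : Set X, IsOpen W ∧ W.Nonempty ∧
      ∃ b : Fin d → ℕ, ∀ n, b ≤ n → ∀ y ∈ W, φ.map n y ∉ W := by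
  let := TopologicalSpace.metrizableSpaceMetric X
  let G : ℕ → Set X := fun k =>
    {x | ∃ n : Fin d → ℕ, (∀ j, k ≤ n j) ∧ dist (φ.map n x) x < 1 / ((k : ℝ) + 1)}
  have hG : ∀ k, IsOpen (G k) := fun k => by
    have : G k = ⋃ (n : Fin d → ℕ) (_ : ∀ j, k ≤ n j),
        {x | dist (φ.map n x) x < 1 / ((k : ℝ) + 1)} := by
      ext x; simp [G]
    rw [this]
    exact isOpen_iUnion fun n => isOpen_iUnion fun _ =>
      isOpen_lt ((φ.isProperMap n).continuous.dist continuous_id) continuous_const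
  have hrec : ⋂ k, G k ⊆ {x : X | φ.IsStronglyRecurrent x} := by
    intro x hx
    have hx' := fun k => mem_iInter.1 hx k
    choose N hN hNx using hx'
    -- the bounds `K i` exceed all coordinates of the earlier times, which makes the times increase
    let K : ℕ → ℕ := fun i => Nat.rec 0 (fun _ k => k + ∑ j, N k j + 1) i
    have hK : ∀ i, K (i + 1) = K i + ∑ j, N (K i) j + 1 := fun i => rfl
    have hKi : ∀ i, i ≤ K i := fun i => by
      induction i with
      | zero => exact Nat.zero_le _
      | succ i ih => rw [hK]; omega
    refine ⟨fun i => N (K i), fun j _ => strictMono_nat_of_lt_succ fun i => ?_, ?_⟩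
    · have h1 := hN (K (i + 1)) j
      have h2 := Finset.single_le_sum (f := fun j => N (K i) j) (fun _ _ => Nat.zero_le _)
        (Finset.mem_univ j)
      have h3 := hK i
      dsimp only at h2 ⊢
      omega
    · refine tendsto_iff_dist_tendsto_zero.2 (squeeze_zero (fun _ => dist_nonneg) (fun i => ?_)
        tendsto_one_div_add_atTop_nhds_zero_nat)
      refine (hNx (K i)).le.trans ?_
      have := hKi i
      gcongr
  obtain ⟨k, hk⟩ : ∃ k, ¬ Dense (G k) := by
    by_contra! hcon
    exact hd ((dense_iInter_of_isOpen_nat hG hcon).mono hrec)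
  obtain ⟨x, hx⟩ : ∃ x, x ∉ closure (G k) := by
    by_contra! hcon
    exact hk hcon
  refine ⟨(closure (G k))ᶜ ∩ Metric.ball x (1 / ((k : ℝ) + 1) / 2),
    isClosed_closure.isOpen_compl.inter Metric.isOpen_ball,
    ⟨x, hx, Metric.mem_ball_self (by positivity)⟩, fun _ => k, fun n hn y hy hny => ?_⟩
  refine hy.1 (subset_closure ⟨n, hn, ?_⟩)
  calc dist (φ.map n y) y ≤ dist (φ.map n y) x + dist y x := dist_triangle_right _ _ _
    _ < 1 / ((k : ℝ) + 1) / 2 + 1 / ((k : ℝ) + 1) / 2 := add_lt_add hny.2 hy.2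
    _ = 1 / ((k : ℝ) + 1) := add_halves _

variable [CompleteSpace H₀] (φ : DynSystem d X) {ρ : C₀(X, ℂ) →⋆ₙₐ[ℂ] (H₀ →L[ℂ] H₀)}

theorem dense_of_primeRadical_eq_bot [TopologicalSpace.MetrizableSpace X] [LocallyCompactSpace X]
    (hρ : Function.Injective ρ) (h : primeRadical (crossedProduct φ ρ) = ⊥) :
    Dense {x : X | φ.IsStronglyRecurrent x} := by
  by_contra hd
  obtain ⟨W, hW, ⟨x, hx⟩, b, hb⟩ := φ.exists_isOpen_forall_map_notMem hd
  obtain ⟨f, hfx, -, hf⟩ := exists_zeroAtInfty_eq_one hW hx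
  have hf0 : f ≠ 0 := fun h0 => by simp [h0] at hfx
  have hzero : ∀ B ∈ crossedProduct φ ρ, mono φ ρ b f * B * mono φ ρ b f = 0 := by
    intro B hB
    rw [mem_crossedProduct] at hB
    refine closure_minimal (t := {B | mono φ ρ b f * B * mono φ ρ b f = 0}) (fun P hP => ?_)
      (isClosed_eq ((continuous_const.mul continuous_id).mul continuous_const) continuous_const) hB
    refine trigPoly_induction φ ρ (p := fun P => mono φ ρ b f * P * mono φ ρ b f = 0)
      (fun n g => ?_) (by rw [mul_zero, zero_mul])
      (fun P Q hP hQ => by rw [mul_add, add_mul, hP, hQ, add_zero])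
      (fun c P hP => by rw [mul_smul_comm, smul_mul_assoc, hP, smul_zero]) hP
    have h0 : φ.α b (φ.α n f * g) * f = 0 := by
      ext y
      change f (φ.map n (φ.map b y)) * g (φ.map b y) * f y = 0
      by_cases hy : y ∈ W
      · have h1 := hb (n + b) le_add_self y hy
        rw [φ.map_add] at h1
        have h2 : f (φ.map n (φ.map b y)) = 0 := hf _ h1
        rw [h2, zero_mul, zero_mul]
      · rw [hf y hy, mul_zero]
    rw [mono_mul, mono_mul, h0, mono_zero]
  have hmem := mem_primeRadical_of_mul_mul_eq_zero
    (a := (⟨mono φ ρ b f, mono_mem_crossedProduct φ ρ b f⟩ : crossedProduct φ ρ))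
    fun B => Subtype.ext (hzero B B.2)
  rw [h, Submodule.mem_bot] at hmem
  exact mono_ne_zero φ hρ b hf0 (congrArg Subtype.val hmem)

end Semiprime

end AnalyticCrossedProduct

end

theorem theorem2p3 {d : ℕ} {X : Type*} [TopologicalSpace X] [TopologicalSpace.MetrizableSpace X]
    [LocallyCompactSpace X] (φ : AnalyticCrossedProduct.DynSystem d X)
    {H₀ : Type*} [NormedAddCommGroup H₀] [InnerProductSpace ℂ H₀] [CompleteSpace H₀]
    (ρ : C₀(X, ℂ) →⋆ₙₐ[ℂ] (H₀ →L[ℂ] H₀)) (hρ : Function.Injective ρ) :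
    List.TFAE
      [Dense {x : X | φ.IsStronglyRecurrent x},
       AnalyticCrossedProduct.IsSemisimple (AnalyticCrossedProduct.crossedProduct φ ρ),
       AnalyticCrossedProduct.IsSemiprime (AnalyticCrossedProduct.crossedProduct φ ρ)] := by
  tfae_have 1 → 2 := AnalyticCrossedProduct.jacobsonRadical_eq_bot_of_dense φ hρ
  tfae_have 2 → 3 := fun h =>
    le_bot_iff.1 (AnalyticCrossedProduct.primeRadical_le_jacobsonRadical.trans h.le)
  tfae_have 3 → 1 := AnalyticCrossedProduct.dense_of_primeRadical_eq_bot φ hρ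
  tfae_finish
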